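/- Let $G$ be a finite group, written additively, with $2^l$ elements ($l\ge 1$). Let $X=Y+Z$, with $Y$ uniform on $G$ and $Z\sim p$ independent of $Y$, let $q$ be a probability distribution on $G$, and let $0\le D\le 1$. Entropies $H$ are in bits, $q\ast d$ denotes convolution, and for $0\le D'\le 1$ let $d_{D'}$ be the distribution on $G$ with $d_{D'}(0)=1-D'$ and $d_{D'}(g)=\frac{D'}{2^l-1}$ for $g\ne 0$; put $d=d_D$. For each block length $n$, two codes $\mathcal C_0,\mathcal C_1$ of $M_0(n),M_1(n)\ge 1$ codewords in $G^n$ are drawn independently of each other and of the source, all letters of all codewords being i.i.d., uniform on $G$ for $\mathcal C_0$ and with law $q$ for $\mathcal C_1$; the rates are $R_i=\lim_n \frac1n\log_2 M_i(n)$. The source word $x^n$ consists of $n$ i.i.d. copies of $X$. Call $(x^n,w^n)$ jointly $\varepsilon$-typical at level $D'$ if it is strongly jointly typical with respect to the law $P_{D'}(x,\hat x)=P_X(x)\,d_{D'}(-x+\hat x)$: with $N(a,b)$ the number of positions at which $(x^n,w^n)$ shows $(a,b)$, one has $|N(a,b)/n-P_{D'}(a,b)|<\varepsilon/|G|^2$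 if $P_{D'}(a,b)>0$, and $N(a,b)=0$ if $P_{D'}(a,b)=0$. A typical encoder with parameters $(D',\varepsilon)$ is any (possibly randomized) rule which, given $x^n$ and the codes, selects $(c_0^n,c_1^n)\in\mathcal C_0\times\mathcal C_1$ with $(x^n,c_0^n+c_1^n)$ jointly $\varepsilon$-typical at level $D'$ if there is such a pair, and otherwise a uniformly random pair. With respect to the constraint $t$ there is an encoder error if $\frac1n d_H(x^n,c_0^n+c_1^n)>t$, where $d_H$ is the Hamming distance; its probability is taken over the source, the codes and the encoder. Suppose that $$R_0>l-H(q\ast d),\qquad R_0+R_1>R_{\mathcal U}(D):=H(X)-H(d).$$ Then: 1. There is $\varepsilon_0>0$ such that for all $0<\varepsilon<\varepsilon_0$ and every sequence of typical encoders with parameters $(\max(0,D-\varepsilon),\varepsilon)$, the probability of an encoder error with respect to the constraint $D$ vanishes as $n\to\infty$. 2. For every $\varepsilon>0$ and every sequence of typical encoders with parameters $(D,\varepsilon)$, the probability of an encoder error with respect to the constraint $D+\varepsilon$ vanishes as $n\to\infty$; and there is a sequence of typical encoders with parameters $(D,\varepsilon)$ for which the probability of an encoder error with respect to the constraint $D$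 itself vanishes. Moreover, if $D\le 1-2^{-l}$, then $R_{\mathcal U}(D)$ is the Hamming-distortion rate-distortion function at $D$ of the uniform source $X$, i.e. the minimum of $I(X;\hat X)$ over all joint laws of $(X,\hat X)$ on $G\times G$ with $X$ distributed as the source and $\Pr(X\ne\hat X)\le D$. -/

import Mathlib

open Filter Topology

namespace SuperpositionCoding

/-- Shannon entropy, in bits, of a probability vector on a finite alphabet. -/
noncomputable def entropy {α : Type*} [Fintype α] (p : α → ℝ) : ℝ :=
  ∑ a, Real.negMulLog (p a) / Real.log 2

/-- The uniform distribution on a finite alphabet. -/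
noncomputable def uniform (α : Type*) [Fintype α] : α → ℝ :=
  fun _ => 1 / (Fintype.card α : ℝ)

/-- The convolution `p ∗ q`: the law of `A + B` for independent `A ∼ p` and `B ∼ q`. -/
def conv {G : Type*} [AddGroup G] [Fintype G] (p q : G → ℝ) : G → ℝ :=
  fun g => ∑ a, p a * q (-a + g)

/-- The law of the source `X = Y + Z`, with `Y` uniform and `Z ∼ p` independent of `Y`. -/
noncomputable def sourceLaw {G : Type*} [AddGroup G] [Fintype G] (p : G → ℝ) : G → ℝ :=
  conv (uniform G) p

/-- The distribution `d` with mass `1 - D` at zero and mass `D` spread evenly over the other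
elements of the group. -/
noncomputable def distortionLaw (G : Type*) [AddGroup G] [Fintype G] [DecidableEq G] (D : ℝ) :
    G → ℝ :=
  fun g => if g = 0 then 1 - D else D / ((Fintype.card G : ℝ) - 1)

/-- The law of `(X, X̂)` under the symmetric test channel: `X` has the law of the source and the
difference between `X̂` and `X` is independent of `X` with law `d`. (The value of `d` at `-x + x̂`
depends only on whether `x = x̂`, so the order of the sum is immaterial.) -/
noncomputable def testLaw {G : Type*} [AddGroup G] [Fintype G] [DecidableEq G]
    (p : G → ℝ) (D : ℝ) : G × G → ℝ :=
  fun a => sourceLaw p a.1 * distortionLaw G D (-a.1 + a.2)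

/-- Number of positions `k` at which the pair of words `(x, w)` shows the pair of letters `a`. -/
def pairCount {α : Type*} [DecidableEq α] {n : ℕ} (x w : Fin n → α) (a : α × α) : ℕ :=
  (Finset.univ.filter fun k => (x k, w k) = a).card

/-- Strong joint typicality of the words `x` and `w` with respect to the joint law `J`, with
tolerance `ε`: the joint empirical frequencies are within `ε / |α|²` of `J`, and pairs of letters
of probability zero do not occur. -/
def JointlyTypical {α : Type*} [Fintype α] [DecidableEq α] (J : α × α → ℝ) (ε : ℝ) {n : ℕ}
    (x w : Fin n → α) : Prop :=
  ∀ a, (0 < J a → |(pairCount x w a : ℝ) / n - J a| < ε / (Fintype.card α : ℝ) ^ 2) ∧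
    (J a = 0 → pairCount x w a = 0)

/-- A code of length `n` over `α` with `M` codewords, listed with possible repetitions. -/
abbrev Code (α : Type*) (n M : ℕ) : Type _ := Fin M → Fin n → α

/-- Probability of the word `x` when its letters are drawn i.i.d. from `p`. -/
noncomputable def wordProb {α : Type*} (p : α → ℝ) {n : ℕ} (x : Fin n → α) : ℝ :=
  ∏ k, p (x k)

/-- Probability of the code `c` when all letters of all codewords are drawn i.i.d. from `p`. -/
noncomputable def codeProb {α : Type*} (p : α → ℝ) {n M : ℕ} (c : Code α n M) : ℝ :=
  ∏ i, wordProb p (c i)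

/-- `M n` is the number of codewords at block length `n` of a family of nonempty codes of rate `R`
bits per symbol. -/
def HasRate (M : ℕ → ℕ) (R : ℝ) : Prop :=
  (∀ n, 0 < M n) ∧ Tendsto (fun n => Real.logb 2 (M n : ℝ) / (n : ℝ)) atTop (𝓝 R)

/-- A (possibly randomized) encoding rule: given the two codes and the source word, it returns a
vector of probabilities of selecting each pair of codewords. -/
abbrev Encoder (α : Type*) (n M₀ M₁ : ℕ) : Type _ :=
  Code α n M₀ → Code α n M₁ → (Fin n → α) → Fin M₀ × Fin M₁ → ℝ

/-- The encoding rule selects a pair `(c₀, c₁)` whose sum is jointly typical with the source word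
whenever there is one, and otherwise a uniformly random pair. -/
structure IsTypicalEncoder {G : Type*} [AddGroup G] [Fintype G] [DecidableEq G]
    (J : G × G → ℝ) (ε : ℝ) {n M₀ M₁ : ℕ} (enc : Encoder G n M₀ M₁) : Prop where
  isLaw : ∀ c₀ c₁ x, enc c₀ c₁ x ∈ stdSimplex ℝ (Fin M₀ × Fin M₁)
  typical : ∀ c₀ c₁ x, (∃ s : Fin M₀ × Fin M₁, JointlyTypical J ε x (c₀ s.1 + c₁ s.2)) →
    ∀ s, enc c₀ c₁ x s ≠ 0 → JointlyTypical J ε x (c₀ s.1 + c₁ s.2)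
  fallback : ∀ c₀ c₁ x, (¬ ∃ s : Fin M₀ × Fin M₁, JointlyTypical J ε x (c₀ s.1 + c₁ s.2)) →
    enc c₀ c₁ x = uniform (Fin M₀ × Fin M₁)

/-- Probability, over the source `x = y + z`, the two random codes and the encoding rule, that the
normalized Hamming distance between `x` and the selected `c₀ + c₁` exceeds `t`. -/
noncomputable def encoderErrorProb {G : Type*} [AddGroup G] [Fintype G] [DecidableEq G]
    (p q : G → ℝ) {n M₀ M₁ : ℕ} (enc : Encoder G n M₀ M₁) (t : ℝ) : ℝ :=
  ∑ y : Fin n → G, ∑ z : Fin n → G, ∑ c₀ : Code G n M₀, ∑ c₁ : Code G n M₁,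
    wordProb (uniform G) y * wordProb p z * codeProb (uniform G) c₀ * codeProb q c₁ *
      ∑ s : Fin M₀ × Fin M₁,
        if t < (hammingDist (y + z) (c₀ s.1 + c₁ s.2) : ℝ) / n then enc c₀ c₁ (y + z) s else 0

/-- Mutual information, in bits, of the two coordinates of a pair with joint law `J`. -/
noncomputable def mutualInfo {α : Type*} [Fintype α] (J : α × α → ℝ) : ℝ :=
  entropy (fun a => ∑ b, J (a, b)) + entropy (fun b => ∑ a, J (a, b)) - entropy J

/-- The values of `I(X; X̂)` over all joint laws of `(X, X̂)` for which `X` has law `P` and the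
expected Hamming distortion `Pr(X ≠ X̂)` is at most `D`; the rate-distortion function of `P` at `D`
is the least element of this set. -/
def achievableInfo {α : Type*} [Fintype α] [DecidableEq α] (P : α → ℝ) (D : ℝ) : Set ℝ :=
  {I | ∃ J ∈ stdSimplex ℝ (α × α), (∀ a, ∑ b, J (a, b) = P a) ∧
    (∑ a : α × α, if a.1 ≠ a.2 then J a else 0) ≤ D ∧ I = mutualInfo J}

end SuperpositionCoding

open SuperpositionCoding

/-! The uniform summand `Y` makes `X` uniform, so `H(X) = l`, and the problem is one of covering:
for most source words `x` and most code pairs, some sum `c₀ + c₁` must fall in a target set `T x`.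
This is proved by a weighted second-moment argument. To a pair of words `(u, v)` give the weight
`|G|^n * d^n(-x + u + v)`, set to zero unless `u + v ∈ T x`, `d^n(-x + u + v) ≤ β₁` and `r^n(-x + u)
≤ β₂`, where `r` is the law of `B - A` for independent `A ∼ q` and `B ∼ d`. As `u` is uniform, the
mean `a` of the weight is the probability of these three events under the test channel, and it tends
to one on averaging over `x`.

Let `K` be the total weight of all pairs of codewords. Two index pairs with different first index
contribute at most `a` to `E K²`, even when they share the second codeword, because averaging the
weight over the uniform `u` alone gives at most one. Hence no condition falls on `R₁` alone.
Coinciding pairs cost a factor `|G|^n β₁`, and a shared first codeword costs `|G|^n β₂`.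
Cauchy–Schwarz gives `a ≤ P(K > 0) * (1 + |G|^n β₁ / (M₀ M₁) + |G|^n β₂ / M₀)`
(`mean_le_prob_exists_pos`, `one_sub_le_prob_exists_mul`). With thresholds near `2^(-n H(d))` and
`2^(-n H(q ∗ d))`, the two rate conditions make the fractions vanish (`tendsto_uncoveredProb`).

The claims about encoders differ only in the choice of `T` and of the noise level; continuity of the
entropies in that level preserves the strict rate conditions. The rate-distortion formula follows
from Gibbs' inequality against the symmetric channel. -/

namespace SuperpositionCoding

/-- Total weight of the outcomes in `S`. -/
noncomputable def prob {Ω : Type*} [Fintype Ω] (w : Ω → ℝ) (S : Set Ω) : ℝ :=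
  ∑ ω, w ω * S.indicator 1 ω

/-! ### Finite weighted probability. -/

section Prob

variable {Ω : Type*} [Fintype Ω] {w : Ω → ℝ}

theorem indicator_one_nonneg {Ω : Type*} (S : Set Ω) (ω : Ω) :
    0 ≤ S.indicator (1 : Ω → ℝ) ω :=
  Set.indicator_nonneg (fun _ _ => zero_le_one) ω

theorem indicator_one_le_one {Ω : Type*} (S : Set Ω) (ω : Ω) :
    S.indicator (1 : Ω → ℝ) ω ≤ 1 :=
  Set.indicator_le_self' (fun _ _ => zero_le_one) ω

theorem prob_nonneg (hw : ∀ ω, 0 ≤ w ω) (S : Set Ω) : 0 ≤ prob w S :=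
  Finset.sum_nonneg fun ω _ => mul_nonneg (hw ω) (indicator_one_nonneg S ω)

theorem prob_mono (hw : ∀ ω, 0 ≤ w ω) {S T : Set Ω}
    (h : ∀ ω, w ω ≠ 0 → ω ∈ S → ω ∈ T) : prob w S ≤ prob w T := by
  refine Finset.sum_le_sum fun ω _ => ?_
  by_cases h0 : w ω = 0
  · simp [h0]
  refine mul_le_mul_of_nonneg_left ?_ (hw ω)
  by_cases hS : ω ∈ S
  · simp [hS, h ω h0 hS]
  · simpa [hS] using indicator_one_nonneg T ω

theorem prob_union_le (hw : ∀ ω, 0 ≤ w ω) (S T : Set Ω) :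
    prob w (S ∪ T) ≤ prob w S + prob w T := by
  rw [prob, prob, prob, ← Finset.sum_add_distrib]
  refine Finset.sum_le_sum fun ω _ => ?_
  rw [← mul_add]
  refine mul_le_mul_of_nonneg_left ?_ (hw ω)
  by_cases hS : ω ∈ S <;> by_cases hT : ω ∈ T <;> simp [hS, hT]

theorem prob_iUnion_le {ι : Type*} [Fintype ι] (hw : ∀ ω, 0 ≤ w ω) (S : ι → Set Ω) :
    prob w (⋃ i, S i) ≤ ∑ i, prob w (S i) := by
  simp only [prob]
  rw [Finset.sum_comm]
  refine Finset.sum_le_sum fun ω _ => ?_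
  rw [← Finset.mul_sum]
  refine mul_le_mul_of_nonneg_left ?_ (hw ω)
  by_cases h : ω ∈ ⋃ i, S i
  · obtain ⟨i, hi⟩ := Set.mem_iUnion.1 h
    rw [Set.indicator_of_mem h]
    calc (1 : ℝ) = (S i).indicator 1 ω := by simp [hi]
      _ ≤ _ := Finset.single_le_sum (f := fun i => (S i).indicator (1 : Ω → ℝ) ω)
        (fun i _ => indicator_one_nonneg _ _) (Finset.mem_univ i)
  · rw [Set.indicator_of_notMem h]
    exact Finset.sum_nonneg fun i _ => indicator_one_nonneg _ _

theorem prob_compl (h1 : ∑ ω, w ω = 1) (S : Set Ω) : prob w Sᶜ = 1 - prob w S := by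
  rw [eq_sub_iff_add_eq, ← h1, prob, prob, ← Finset.sum_add_distrib]
  refine Finset.sum_congr rfl fun ω _ => ?_
  by_cases hS : ω ∈ S <;> simp [hS]

end Prob

/-! ### Moments of functions of i.i.d. words. -/

section IID

variable {α : Type*} [Fintype α] {P : α → ℝ} {n : ℕ}

theorem wordProb_nonneg {α : Type*} {P : α → ℝ} {n : ℕ} (hP : ∀ a, 0 ≤ P a) (x : Fin n → α) :
    0 ≤ wordProb P x :=
  Finset.prod_nonneg fun _ _ => hP _

/-- Independence, as distributivity of product over sum. The alphabet is arbitrary, so this also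
serves for codes, whose letters are whole codewords. -/
theorem sum_wordProb_mul_prod (g : Fin n → α → ℝ) :
    ∑ x : Fin n → α, wordProb P x * ∏ k, g k (x k) = ∏ k, ∑ a, P a * g k a := by
  classical
  simp [Finset.prod_univ_sum, wordProb, Finset.prod_mul_distrib]

theorem sum_wordProb (h1 : ∑ a, P a = 1) : ∑ x : Fin n → α, wordProb P x = 1 := by
  simpa [h1] using sum_wordProb_mul_prod (P := P) (n := n) (fun _ _ => 1)

theorem sum_wordProb_mul_apply (h1 : ∑ a, P a = 1) (i : Fin n) (F : α → ℝ) :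
    ∑ x : Fin n → α, wordProb P x * F (x i) = ∑ a, P a * F a := by
  have h := sum_wordProb_mul_prod (P := P) (fun k a => if k = i then F a else 1)
  rw [Finset.prod_eq_single i (fun k _ hk => by simp [hk, h1]) (by simp)] at h
  simpa [Finset.prod_ite_eq'] using h

theorem sum_wordProb_mul_apply_mul_apply (h1 : ∑ a, P a = 1) {i j : Fin n} (hij : i ≠ j)
    (F G : α → ℝ) :
    ∑ x : Fin n → α, wordProb P x * (F (x i) * G (x j)) =
      (∑ a, P a * F a) * ∑ a, P a * G a := by
  have h := sum_wordProb_mul_prod (P := P)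
    (fun k a => (if k = i then F a else 1) * (if k = j then G a else 1))
  rw [Finset.prod_eq_mul i j hij (fun k _ hk => by simp [hk, h1]) (by simp) (by simp)] at h
  simp only [Finset.prod_mul_distrib, Finset.prod_ite_eq', Finset.mem_univ, if_true, hij,
    hij.symm, if_false, mul_one, one_mul] at h
  exact h

theorem sum_wordProb_mul_apply₂ (h1 : ∑ a, P a = 1) {i j : Fin n} (hij : i ≠ j)
    (F : α → α → ℝ) :
    ∑ x : Fin n → α, wordProb P x * F (x i) (x j) = ∑ a, P a * ∑ b, P b * F a b := by
  classical
  have hF : ∀ x : Fin n → α, wordProb P x * F (x i) (x j) =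
      ∑ a, wordProb P x * ((if x i = a then 1 else 0) * F a (x j)) := by
    intro x
    simp
  simp_rw [hF]
  rw [Finset.sum_comm]
  refine Finset.sum_congr rfl fun a _ => ?_
  rw [sum_wordProb_mul_apply_mul_apply h1 hij (fun c => if c = a then 1 else 0) (F a)]
  simp

end IID

/-! ### Second-moment method for two independent codes. -/

section SecondMoment

variable {U V : Type*} [Fintype U] [Fintype V] {P : U → ℝ} {Q : V → ℝ} {f : U → V → ℝ}
  {B₁ B₂ : ℝ}

/-- The four cases of equal or distinct indices. If both agree, one factor `f` is bounded by `B₁`.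
If only the first agrees, conditioning on `u` bounds one factor by `B₂`. If only the second agrees,
conditioning on `v` bounds one factor by `1`. If both differ, the moment is the squared mean, which
is at most the mean. -/
theorem pair_moment_le (hP : ∀ u, 0 ≤ P u) (hP1 : ∑ u, P u = 1) (hQ : ∀ v, 0 ≤ Q v)
    (hQ1 : ∑ v, Q v = 1) (hf : ∀ u v, 0 ≤ f u v) (hB₂0 : 0 ≤ B₂)
    (hB₁ : ∀ u v, f u v ≤ B₁) (hB₂ : ∀ u, ∑ v, Q v * f u v ≤ B₂)
    (h1 : ∀ v, ∑ u, P u * f u v ≤ 1) {M₀ M₁ : ℕ} (i i' : Fin M₀) (j j' : Fin M₁) :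
    ∑ c₀ : Fin M₀ → U, wordProb P c₀ * ∑ c₁ : Fin M₁ → V, wordProb Q c₁ *
        (f (c₀ i) (c₁ j) * f (c₀ i') (c₁ j')) ≤
      (∑ u, P u * ∑ v, Q v * f u v) *
        ((if i = i' then if j = j' then B₁ else 0 else 0) + (if i = i' then B₂ else 0) + 1) := by
  have hg : ∀ u, 0 ≤ ∑ v, Q v * f u v :=
    fun u => Finset.sum_nonneg fun v _ => mul_nonneg (hQ v) (hf u v)
  have hh : ∀ v, 0 ≤ ∑ u, P u * f u v :=
    fun v => Finset.sum_nonneg fun u _ => mul_nonneg (hP u) (hf u v)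
  have ha : 0 ≤ ∑ u, P u * ∑ v, Q v * f u v :=
    Finset.sum_nonneg fun u _ => mul_nonneg (hP u) (hg u)
  have hswap : ∑ u, P u * ∑ v, Q v * f u v = ∑ v, Q v * ∑ u, P u * f u v := by
    simp_rw [Finset.mul_sum]
    rw [Finset.sum_comm]
    exact Finset.sum_congr rfl fun v _ => Finset.sum_congr rfl fun u _ => by ring
  have ha1 : ∑ u, P u * ∑ v, Q v * f u v ≤ 1 := by
    rw [hswap, ← hQ1]
    exact Finset.sum_le_sum fun v _ => by
      simpa using mul_le_mul_of_nonneg_left (h1 v) (hQ v)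
  by_cases hi : i = i'
  · subst hi
    by_cases hj : j = j'
    · subst hj
      simp_rw [fun u u' => sum_wordProb_mul_apply hQ1 j (fun v => f u v * f u' v)]
      rw [sum_wordProb_mul_apply hP1 i (fun u => ∑ v, Q v * (f u v * f u v))]
      have : ∑ u, P u * ∑ v, Q v * (f u v * f u v) ≤ (∑ u, P u * ∑ v, Q v * f u v) * B₁ := by
        rw [Finset.sum_mul]
        refine Finset.sum_le_sum fun u _ => ?_
        rw [mul_assoc, Finset.sum_mul]
        refine mul_le_mul_of_nonneg_left (Finset.sum_le_sum fun v _ => ?_) (hP u)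
        rw [mul_assoc]
        exact mul_le_mul_of_nonneg_left
          (mul_le_mul_of_nonneg_left (hB₁ u v) (hf u v)) (hQ v)
      simp only [if_true]
      nlinarith [mul_nonneg ha hB₂0]
    · simp_rw [fun u u' => sum_wordProb_mul_apply₂ hQ1 hj (fun v v' => f u v * f u' v')]
      rw [sum_wordProb_mul_apply hP1 i
        (fun u => ∑ v, Q v * ∑ v', Q v' * (f u v * f u v'))]
      have : ∑ u, P u * ∑ v, Q v * ∑ v', Q v' * (f u v * f u v') ≤
          (∑ u, P u * ∑ v, Q v * f u v) * B₂ := by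
        rw [Finset.sum_mul]
        refine Finset.sum_le_sum fun u _ => ?_
        have e : ∑ v, Q v * ∑ v', Q v' * (f u v * f u v') =
            (∑ v, Q v * f u v) * ∑ v, Q v * f u v := by
          rw [Finset.sum_mul]
          refine Finset.sum_congr rfl fun v _ => ?_
          rw [Finset.mul_sum, Finset.mul_sum]
          exact Finset.sum_congr rfl fun v' _ => by ring
        rw [e, mul_assoc]
        exact mul_le_mul_of_nonneg_left (mul_le_mul_of_nonneg_left (hB₂ u) (hg u)) (hP u)
      simp only [if_true, if_neg hj]
      nlinarith [mul_nonneg ha hB₂0]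
  · simp only [if_neg hi, zero_add, mul_one]
    by_cases hj : j = j'
    · subst hj
      simp_rw [fun u u' => sum_wordProb_mul_apply hQ1 j (fun v => f u v * f u' v)]
      rw [sum_wordProb_mul_apply₂ hP1 hi (fun u u' => ∑ v, Q v * (f u v * f u' v)), hswap]
      have e : ∑ u, P u * ∑ u', P u' * ∑ v, Q v * (f u v * f u' v) =
          ∑ v, Q v * ((∑ u, P u * f u v) * ∑ u, P u * f u v) := by
        simp_rw [Finset.mul_sum, Finset.sum_mul, Finset.mul_sum]
        rw [Finset.sum_congr rfl fun u _ => Finset.sum_comm, Finset.sum_comm]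
        exact Finset.sum_congr rfl fun v _ => Finset.sum_comm.trans <|
          Finset.sum_congr rfl fun u _ => Finset.sum_congr rfl fun u' _ => by ring
      rw [e]
      exact Finset.sum_le_sum fun v _ => mul_le_mul_of_nonneg_left
        (mul_le_of_le_one_left (hh v) (h1 v)) (hQ v)
    · simp_rw [fun u u' => sum_wordProb_mul_apply₂ hQ1 hj (fun v v' => f u v * f u' v')]
      rw [sum_wordProb_mul_apply₂ hP1 hi
        (fun u u' => ∑ v, Q v * ∑ v', Q v' * (f u v * f u' v'))]
      have e : ∑ u, P u * ∑ u', P u' * ∑ v, Q v * ∑ v', Q v' * (f u v * f u' v') =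
          (∑ u, P u * ∑ v, Q v * f u v) * ∑ u, P u * ∑ v, Q v * f u v := by
        have e' : ∀ u u', ∑ v, Q v * ∑ v', Q v' * (f u v * f u' v') =
            (∑ v, Q v * f u v) * ∑ v, Q v * f u' v := by
          intro u u'
          rw [Finset.sum_mul]
          refine Finset.sum_congr rfl fun v _ => ?_
          rw [Finset.mul_sum, Finset.mul_sum]
          exact Finset.sum_congr rfl fun v' _ => by ring
        simp_rw [e']
        rw [Finset.sum_mul]
        refine Finset.sum_congr rfl fun u _ => ?_
        rw [Finset.mul_sum, Finset.mul_sum]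
        exact Finset.sum_congr rfl fun u' _ => by ring
      rw [e]
      exact mul_le_of_le_one_left ha ha1

/-- Law of a pair of independent codes with i.i.d. codewords. -/
noncomputable def codePairProb (P : U → ℝ) (Q : V → ℝ) {M₀ M₁ : ℕ}
    (c : (Fin M₀ → U) × (Fin M₁ → V)) : ℝ :=
  wordProb P c.1 * wordProb Q c.2

theorem sum_codePairProb (hP1 : ∑ u, P u = 1) (hQ1 : ∑ v, Q v = 1) {M₀ M₁ : ℕ} :
    ∑ c : (Fin M₀ → U) × (Fin M₁ → V), codePairProb P Q c = 1 := by
  simp [Fintype.sum_prod_type, codePairProb, ← Finset.mul_sum, sum_wordProb hP1,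
    sum_wordProb hQ1]

/-- Second-moment bound for the existence of a pair of codewords on which `f` is positive. -/
theorem mean_le_prob_exists_pos (hP : ∀ u, 0 ≤ P u) (hP1 : ∑ u, P u = 1) (hQ : ∀ v, 0 ≤ Q v)
    (hQ1 : ∑ v, Q v = 1) (hf : ∀ u v, 0 ≤ f u v) (hB₁0 : 0 ≤ B₁) (hB₂0 : 0 ≤ B₂)
    (hB₁ : ∀ u v, f u v ≤ B₁) (hB₂ : ∀ u, ∑ v, Q v * f u v ≤ B₂)
    (h1 : ∀ v, ∑ u, P u * f u v ≤ 1) {M₀ M₁ : ℕ} (hM₀ : 0 < M₀) (hM₁ : 0 < M₁) :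
    ∑ u, P u * ∑ v, Q v * f u v ≤
      prob (codePairProb P Q) {c : (Fin M₀ → U) × (Fin M₁ → V) |
        ∃ s : Fin M₀ × Fin M₁, 0 < f (c.1 s.1) (c.2 s.2)} *
      (1 + B₁ / (M₀ * M₁) + B₂ / M₀) := by
  set S := {c : (Fin M₀ → U) × (Fin M₁ → V) |
    ∃ s : Fin M₀ × Fin M₁, 0 < f (c.1 s.1) (c.2 s.2)} with hS
  set a := ∑ u, P u * ∑ v, Q v * f u v with ha
  have ha0 : 0 ≤ a := Finset.sum_nonneg fun u _ => mul_nonneg (hP u) <|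
    Finset.sum_nonneg fun v _ => mul_nonneg (hQ v) (hf u v)
  have hw : ∀ c : (Fin M₀ → U) × (Fin M₁ → V), 0 ≤ codePairProb P Q c :=
    fun c => mul_nonneg (wordProb_nonneg hP _) (wordProb_nonneg hQ _)
  have hpS := prob_nonneg hw S
  have hm₀ : (0 : ℝ) < M₀ := Nat.cast_pos.2 hM₀
  have hm₁ : (0 : ℝ) < M₁ := Nat.cast_pos.2 hM₁
  have hC : 0 ≤ 1 + B₁ / (M₀ * M₁) + B₂ / M₀ := by positivity
  rcases ha0.eq_or_lt with h0 | hapos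
  · rw [← h0]
    exact mul_nonneg hpS hC
  -- The random variable of the second-moment method; it vanishes off `S`.
  let K : (Fin M₀ → U) × (Fin M₁ → V) → ℝ := fun c => ∑ i, ∑ j, f (c.1 i) (c.2 j)
  have hEK : ∑ c, codePairProb P Q c * K c = M₀ * M₁ * a := by
    have : ∀ (i : Fin M₀) (j : Fin M₁),
        ∑ c : (Fin M₀ → U) × (Fin M₁ → V), codePairProb P Q c * f (c.1 i) (c.2 j) = a := by
      intro i j
      simp_rw [codePairProb, mul_assoc]
      rw [Fintype.sum_prod_type]
      simp_rw [← Finset.mul_sum]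
      simp_rw [fun u => sum_wordProb_mul_apply hQ1 j (fun v => f u v)]
      rw [sum_wordProb_mul_apply hP1 i (fun u => ∑ v, Q v * f u v)]
    simp_rw [K, Finset.mul_sum]
    rw [Finset.sum_comm, Finset.sum_congr rfl fun i _ => Finset.sum_comm]
    simp [this, mul_assoc]
  have hEK2 : ∑ c, codePairProb P Q c * K c ^ 2 ≤
      a * (M₀ * M₁ * B₁ + M₀ * (M₁ * M₁) * B₂ + M₀ * M₀ * (M₁ * M₁)) := by
    have hK2 : ∀ c, codePairProb P Q c * K c ^ 2 = ∑ i, ∑ i', ∑ j, ∑ j',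
        codePairProb P Q c * (f (c.1 i) (c.2 j) * f (c.1 i') (c.2 j')) := by
      intro c
      simp_rw [K, sq, Finset.sum_mul_sum, Finset.mul_sum]
    have hle : ∑ i : Fin M₀, ∑ i' : Fin M₀, ∑ j : Fin M₁, ∑ j' : Fin M₁,
        ∑ c : (Fin M₀ → U) × (Fin M₁ → V),
          codePairProb P Q c * (f (c.1 i) (c.2 j) * f (c.1 i') (c.2 j')) ≤
        ∑ i : Fin M₀, ∑ i' : Fin M₀, ∑ j : Fin M₁, ∑ j' : Fin M₁,
          a * ((if i = i' then if j = j' then B₁ else 0 else 0) +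
            (if i = i' then B₂ else 0) + 1) := by
      refine Finset.sum_le_sum fun i _ => Finset.sum_le_sum fun i' _ =>
        Finset.sum_le_sum fun j _ => Finset.sum_le_sum fun j' _ => ?_
      refine le_trans (le_of_eq ?_) (pair_moment_le hP hP1 hQ hQ1 hf hB₂0 hB₁ hB₂ h1
        i i' j j')
      simp_rw [codePairProb, mul_assoc]
      rw [Fintype.sum_prod_type]
      simp_rw [← Finset.mul_sum]
    simp_rw [hK2]
    refine le_trans (le_of_eq ?_) (hle.trans (le_of_eq ?_))
    · rw [Finset.sum_comm]
      refine Finset.sum_congr rfl fun i _ => ?_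
      rw [Finset.sum_comm]
      refine Finset.sum_congr rfl fun i' _ => ?_
      rw [Finset.sum_comm]
      refine Finset.sum_congr rfl fun j _ => ?_
      rw [Finset.sum_comm]
    simp_rw [← Finset.mul_sum, Finset.sum_add_distrib]
    congr 1
    simp
    ring
  -- Cauchy–Schwarz for `K = K * 1_S`.
  have hCS : (∑ c, codePairProb P Q c * K c) ^ 2 ≤
      prob (codePairProb P Q) S * ∑ c, codePairProb P Q c * K c ^ 2 := by
    refine Finset.sum_sq_le_sum_mul_sum_of_sq_le_mul _
      (fun c _ => mul_nonneg (hw c) (indicator_one_nonneg S c))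
      (fun c _ => mul_nonneg (hw c) (sq_nonneg _)) fun c _ => le_of_eq ?_
    by_cases hc : c ∈ S
    · simp [hc]; ring
    · have hK : K c = 0 := by
        refine Finset.sum_eq_zero fun i _ => Finset.sum_eq_zero fun j _ => ?_
        refine le_antisymm (not_lt.1 fun h => hc ⟨(i, j), h⟩) (hf _ _)
      simp [hK]
  rw [hEK] at hCS
  have h2 := hCS.trans (mul_le_mul_of_nonneg_left hEK2 hpS)
  have h3 : prob (codePairProb P Q) S *
      (a * (M₀ * M₁ * B₁ + M₀ * (M₁ * M₁) * B₂ + M₀ * M₀ * (M₁ * M₁))) =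
      (M₀ * M₁) ^ 2 * a * (prob (codePairProb P Q) S * (1 + B₁ / (M₀ * M₁) + B₂ / M₀)) := by
    field_simp
    ring
  rw [h3] at h2
  have h4 : (0 : ℝ) < (M₀ * M₁) ^ 2 * a := by positivity
  refine le_of_mul_le_mul_left ?_ h4
  calc _ = (M₀ * M₁ * a) ^ 2 := by ring
    _ ≤ _ := h2

end SecondMoment

/-! ### Weak law of large numbers and asymptotic equipartition. -/

section LawOfLargeNumbers

variable {α : Type*} [Fintype α] {P : α → ℝ}

theorem sum_wordProb_mul_sum_sq (h1 : ∑ a, P a = 1) {ψ : α → ℝ} (hψ : ∑ a, P a * ψ a = 0)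
    (n : ℕ) :
    ∑ x : Fin n → α, wordProb P x * (∑ k, ψ (x k)) ^ 2 = n * ∑ a, P a * ψ a ^ 2 := by
  have h : ∀ i j : Fin n, ∑ x : Fin n → α, wordProb P x * (ψ (x i) * ψ (x j)) =
      if i = j then ∑ a, P a * ψ a ^ 2 else 0 := by
    intro i j
    by_cases hij : i = j
    · subst hij
      rw [sum_wordProb_mul_apply h1 i (fun a => ψ a * ψ a)]
      simp [sq]
    · rw [sum_wordProb_mul_apply_mul_apply h1 hij, hψ]
      simp [hij]
  simp_rw [sq (∑ k, ψ _), Finset.sum_mul_sum, Finset.mul_sum]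
  rw [Finset.sum_comm, Finset.sum_congr rfl fun i _ => Finset.sum_comm]
  simp [h]
  rw [Finset.mul_sum]

/-- Chebyshev's inequality for the empirical mean of an i.i.d. word. -/
theorem prob_le_abs_mean_sub (hP : ∀ a, 0 ≤ P a) (h1 : ∑ a, P a = 1) (φ : α → ℝ) {δ : ℝ}
    (hδ : 0 < δ) {n : ℕ} (hn : 0 < n) :
    prob (wordProb P) {x : Fin n → α | δ ≤ |(∑ k, φ (x k)) / n - ∑ a, P a * φ a|} ≤
      (∑ a, P a * (φ a - ∑ b, P b * φ b) ^ 2) / δ ^ 2 / n := by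
  set m := ∑ a, P a * φ a with hm
  have hψ : ∑ a, P a * (φ a - m) = 0 := by
    simp_rw [mul_sub, Finset.sum_sub_distrib, ← Finset.sum_mul, h1, one_mul, hm, sub_self]
  have hn' : (0 : ℝ) < n := Nat.cast_pos.2 hn
  have hv := sum_wordProb_mul_sum_sq h1 hψ n
  have hle : prob (wordProb P) {x : Fin n → α | δ ≤ |(∑ k, φ (x k)) / n - m|} * (n * δ) ^ 2 ≤
      ∑ x : Fin n → α, wordProb P x * (∑ k, (φ (x k) - m)) ^ 2 := by
    rw [prob, Finset.sum_mul]
    refine Finset.sum_le_sum fun x _ => ?_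
    rw [mul_assoc]
    refine mul_le_mul_of_nonneg_left ?_ (wordProb_nonneg hP x)
    by_cases hx : δ ≤ |(∑ k, φ (x k)) / n - m|
    · rw [Set.indicator_of_mem (by exact hx), Pi.one_apply, one_mul, ← sq_abs (∑ k, _)]
      have : (∑ k, (φ (x k) - m)) = n * ((∑ k, φ (x k)) / n - m) := by
        rw [Finset.sum_sub_distrib]
        simp
        field_simp
      rw [this, abs_mul, abs_of_pos hn']
      gcongr
    · rw [Set.indicator_of_notMem (by exact hx), zero_mul]
      exact sq_nonneg _
  rw [hv] at hle
  rw [le_div_iff₀ hn', le_div_iff₀ (by positivity)]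
  refine le_of_mul_le_mul_left ?_ hn'
  calc _ = _ := by ring
    _ ≤ _ := hle

/-- Weak law of large numbers for i.i.d. words. -/
theorem tendsto_prob_mean_notMem (hP : ∀ a, 0 ≤ P a) (h1 : ∑ a, P a = 1) (φ : α → ℝ) {U : Set ℝ}
    (hU : U ∈ 𝓝 (∑ a, P a * φ a)) :
    Tendsto (fun n : ℕ => prob (wordProb P) {x : Fin n → α | (∑ k, φ (x k)) / n ∉ U})
      atTop (𝓝 0) := by
  obtain ⟨δ, hδ, hball⟩ := Metric.mem_nhds_iff.1 hU
  refine squeeze_zero' (Eventually.of_forall fun n => prob_nonneg (wordProb_nonneg hP) _) ?_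
    (tendsto_const_div_atTop_nhds_zero_nat
      ((∑ a, P a * (φ a - ∑ b, P b * φ b) ^ 2) / δ ^ 2))
  filter_upwards [eventually_gt_atTop 0] with n hn
  refine (prob_mono (wordProb_nonneg hP) fun x _ hx => ?_).trans
    (prob_le_abs_mean_sub hP h1 φ hδ hn)
  by_contra h
  refine hx (hball ?_)
  rw [Metric.mem_ball, Real.dist_eq]
  exact not_le.1 h

theorem log_two_mul_entropy (P : α → ℝ) :
    entropy P * Real.log 2 = ∑ a, P a * -Real.log (P a) := by
  rw [entropy, Finset.sum_mul]
  refine Finset.sum_congr rfl fun a _ => ?_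
  have : Real.log 2 ≠ 0 := (Real.log_pos one_lt_two).ne'
  rw [div_mul_cancel₀ _ this, Real.negMulLog]
  ring

/-- An i.i.d. word is unlikely to have a probability much above `2 ^ (-n H)`. -/
theorem tendsto_prob_rpow_lt_wordProb (hP : ∀ a, 0 ≤ P a) (h1 : ∑ a, P a = 1) {δ : ℝ}
    (hδ : 0 < δ) :
    Tendsto (fun n : ℕ => prob (wordProb P)
      {x : Fin n → α | (2 : ℝ) ^ (-(n * (entropy P - δ))) < wordProb P x}) atTop (𝓝 0) := by
  have hl2 := Real.log_pos one_lt_two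
  have hU : Set.Ioi ((entropy P - δ) * Real.log 2) ∈ 𝓝 (∑ a, P a * -Real.log (P a)) := by
    rw [← log_two_mul_entropy]
    exact Ioi_mem_nhds (mul_lt_mul_of_pos_right (by linarith) hl2)
  refine squeeze_zero' (Eventually.of_forall fun n => prob_nonneg (wordProb_nonneg hP) _) ?_
    (tendsto_prob_mean_notMem hP h1 (fun a => -Real.log (P a)) hU)
  filter_upwards [eventually_gt_atTop 0] with n hn
  have hn' : (0 : ℝ) < n := Nat.cast_pos.2 hn
  -- Only words of nonzero probability count, so the logarithm of the product splits and the value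
  -- `Real.log 0 = 0` never enters.
  refine prob_mono (wordProb_nonneg hP) fun x hx0 hx => ?_
  have hx' : (2 : ℝ) ^ (-(n * (entropy P - δ))) < wordProb P x := hx
  have hlog := Real.log_lt_log (Real.rpow_pos_of_pos two_pos _) hx'
  rw [Real.log_rpow two_pos, wordProb,
    Real.log_prod fun k _ => (Finset.prod_ne_zero_iff.1 hx0) k (Finset.mem_univ k)] at hlog
  simp only [Set.mem_ofPred_eq, Set.mem_Ioi, not_lt, Finset.sum_neg_distrib]
  rw [div_le_iff₀ hn']
  linarith

end LawOfLargeNumbers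

/-! ### Exponential growth of code sizes. -/

section Rates

theorem HasRate.tendsto_rpow_div {M : ℕ → ℕ} {R c : ℝ} (hM : HasRate M R) (hc : c < R) :
    Tendsto (fun n : ℕ => (2 : ℝ) ^ (n * c) / M n) atTop (𝓝 0) := by
  obtain ⟨c', hcc', hc'R⟩ := exists_between hc
  have hgeo : Tendsto (fun n : ℕ => ((2 : ℝ) ^ (c - c')) ^ n) atTop (𝓝 0) :=
    tendsto_pow_atTop_nhds_zero_of_lt_one (by positivity)
      (Real.rpow_lt_one_of_one_lt_of_neg one_lt_two (by linarith))
  refine squeeze_zero' (Eventually.of_forall fun n => by positivity) ?_ hgeo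
  filter_upwards [eventually_gt_atTop 0, hM.2.eventually (lt_mem_nhds hc'R)] with n hn hlt
  have hn' : (0 : ℝ) < n := Nat.cast_pos.2 hn
  have hMpos : (0 : ℝ) < M n := Nat.cast_pos.2 (hM.1 n)
  rw [lt_div_iff₀ hn', Real.lt_logb_iff_rpow_lt one_lt_two hMpos] at hlt
  rw [div_le_iff₀ hMpos, ← Real.rpow_natCast, ← Real.rpow_mul two_pos.le]
  calc (2 : ℝ) ^ (n * c) = 2 ^ ((c - c') * n) * 2 ^ (c' * n) := by
        rw [← Real.rpow_add two_pos]; ring_nf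
    _ ≤ _ := mul_le_mul_of_nonneg_left hlt.le (by positivity)

theorem HasRate.mul {M M' : ℕ → ℕ} {R R' : ℝ} (hM : HasRate M R) (hM' : HasRate M' R') :
    HasRate (fun n => M n * M' n) (R + R') := by
  refine ⟨fun n => Nat.mul_pos (hM.1 n) (hM'.1 n), (hM.2.add hM'.2).congr fun n => ?_⟩
  have h := (hM.1 n).ne'
  have h' := (hM'.1 n).ne'
  push_cast
  rw [Real.logb_mul (by exact_mod_cast h) (by exact_mod_cast h'), add_div]

end Rates

/-! ### Covering by sums of codewords. -/

section Covering

variable {G : Type*} [AddGroup G] [Fintype G]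

theorem card_pos_real (G : Type*) [AddGroup G] [Fintype G] : (0 : ℝ) < Fintype.card G :=
  Nat.cast_pos.2 Fintype.card_pos

theorem uniform_nonneg (α : Type*) [Fintype α] (a : α) : 0 ≤ uniform α a := by
  unfold uniform
  positivity

theorem sum_uniform (G : Type*) [AddGroup G] [Fintype G] : ∑ g, uniform G g = 1 := by
  have := (card_pos_real G).ne'
  simp [uniform, this]

theorem wordProb_uniform_mul {n : ℕ} (x : Fin n → G) :
    wordProb (uniform G) x * (Fintype.card G : ℝ) ^ n = 1 := by
  have := (card_pos_real G).ne'
  simp [wordProb, uniform, this]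

/-- The law of `B - A` for independent `A ∼ q` and `B ∼ d`. -/
def subLaw (q d : G → ℝ) : G → ℝ :=
  fun g => ∑ c, q c * d (g + c)

theorem subLaw_nonneg {q d : G → ℝ} (hq : ∀ g, 0 ≤ q g) (hd : ∀ g, 0 ≤ d g) (g : G) :
    0 ≤ subLaw q d g :=
  Finset.sum_nonneg fun c _ => mul_nonneg (hq c) (hd _)

theorem sum_subLaw {q d : G → ℝ} (hq1 : ∑ g, q g = 1) (hd1 : ∑ g, d g = 1) :
    ∑ g, subLaw q d g = 1 := by
  simp only [subLaw]
  rw [Finset.sum_comm]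
  have h : ∀ c : G, ∑ g, d (g + c) = 1 := fun c => (Equiv.sum_comp (Equiv.addRight c) d).trans hd1
  simp_rw [← Finset.mul_sum, h, mul_one, hq1]

/-- Averaging the channel weight over the second codeword leaves an i.i.d. law, so a threshold on
that law controls the mean weight given the first codeword. -/
theorem wordProb_subLaw (q d : G → ℝ) {n : ℕ} (z : Fin n → G) :
    wordProb (subLaw q d) z = ∑ v : Fin n → G, wordProb q v * wordProb d (z + v) :=
  (sum_wordProb_mul_prod (P := q) fun k a => d (z k + a)).symm

theorem sum_add_add {n : ℕ} (x v : Fin n → G) (F : (Fin n → G) → ℝ) :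
    ∑ u, F (x + u + v) = ∑ e, F e :=
  ((Equiv.addLeft x).trans (Equiv.addRight v)).sum_comp F

theorem prob_wordProb_prod (P : G → ℝ) (d : G → ℝ) {n : ℕ} (T : (Fin n → G) → Set (Fin n → G)) :
    prob (wordProb fun a : G × G => P a.1 * d (-a.1 + a.2))
        {ω : Fin n → G × G | (fun k => (ω k).2) ∈ T fun k => (ω k).1} =
      ∑ x, wordProb P x * ∑ w, wordProb d (-x + w) * (T x).indicator 1 w := by
  rw [prob, ← (Equiv.arrowProdEquivProdArrow (Fin n) (fun _ => G) (fun _ => G)).symm.sum_comp,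
    Fintype.sum_prod_type]
  refine Finset.sum_congr rfl fun x _ => ?_
  rw [Finset.mul_sum]
  refine Finset.sum_congr rfl fun w _ => ?_
  rw [← mul_assoc]
  refine congrArg₂ (· * ·) ?_ ?_
  · simp [wordProb, Equiv.arrowProdEquivProdArrow, Finset.prod_mul_distrib]
  · rfl

/-- One-shot covering bound for sums of codewords of two independent codes, the first of which has
uniform letters. -/
theorem one_sub_le_prob_exists_mul {q d : G → ℝ} (hq : ∀ g, 0 ≤ q g) (hq1 : ∑ g, q g = 1)
    (hd : ∀ g, 0 ≤ d g) (hd1 : ∑ g, d g = 1) {n : ℕ} (T : (Fin n → G) → Set (Fin n → G))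
    {β₁ β₂ : ℝ} (hβ₁ : 0 ≤ β₁) (hβ₂ : 0 ≤ β₂) {M₀ M₁ : ℕ} (hM₀ : 0 < M₀) (hM₁ : 0 < M₁) :
    1 - prob (wordProb fun a : G × G => uniform G a.1 * d (-a.1 + a.2))
          {ω : Fin n → G × G | (fun k => (ω k).2) ∈ (T fun k => (ω k).1)ᶜ} -
        prob (wordProb d) {e : Fin n → G | β₁ < wordProb d e} -
        prob (wordProb (subLaw q d)) {z : Fin n → G | β₂ < wordProb (subLaw q d) z} ≤
      (∑ x, wordProb (uniform G) x * prob (codePairProb (wordProb (uniform G)) (wordProb q))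
        {c : Code G n M₀ × Code G n M₁ |
          ∃ s : Fin M₀ × Fin M₁, c.1 s.1 + c.2 s.2 ∈ T x}) *
      (1 + Fintype.card G ^ n * β₁ / (M₀ * M₁) + Fintype.card G ^ n * β₂ / M₀) := by
  set N : ℝ := (Fintype.card G : ℝ) ^ n with hN
  have hNpos : 0 < N := pow_pos (card_pos_real G) n
  have hU0 : ∀ x : Fin n → G, 0 ≤ wordProb (uniform G) x :=
    wordProb_nonneg (uniform_nonneg G)
  have hU1 : ∑ x : Fin n → G, wordProb (uniform G) x = 1 := sum_wordProb (sum_uniform G)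
  have hQ0 : ∀ v : Fin n → G, 0 ≤ wordProb q v := wordProb_nonneg hq
  have hQ1 : ∑ v : Fin n → G, wordProb q v = 1 := sum_wordProb hq1
  have hd0 : ∀ e : Fin n → G, 0 ≤ wordProb d e := wordProb_nonneg hd
  have hds : ∑ e : Fin n → G, wordProb d e = 1 := sum_wordProb hd1
  -- The last two conditions are truncations that provide the bounds `B₁ = N * β₁` and `B₂ = N *
  -- β₂`.
  let A : (Fin n → G) → Set ((Fin n → G) × (Fin n → G)) := fun x =>
    {c | c.1 + c.2 ∈ T x ∧ wordProb d (-x + c.1 + c.2) ≤ β₁ ∧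
      wordProb (subLaw q d) (-x + c.1) ≤ β₂}
  -- The factor `N` cancels the uniform probability of `u`, turning the mean into a channel
  -- probability.
  let f : (Fin n → G) → (Fin n → G) → (Fin n → G) → ℝ := fun x u v =>
    N * (wordProb d (-x + u + v) * (A x).indicator 1 (u, v))
  have hf0 : ∀ x u v, 0 ≤ f x u v := fun x u v =>
    mul_nonneg hNpos.le (mul_nonneg (hd0 _) (indicator_one_nonneg _ _))
  have hUN : ∀ (u : Fin n → G) (r : ℝ), wordProb (uniform G) u * (N * r) = r := fun u r => by
    rw [← mul_assoc, wordProb_uniform_mul, one_mul]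
  have hx : ∀ x, ∑ u, wordProb (uniform G) u * ∑ v, wordProb q v * f x u v ≤
      prob (codePairProb (wordProb (uniform G)) (wordProb q))
        {c : Code G n M₀ × Code G n M₁ |
          ∃ s : Fin M₀ × Fin M₁, c.1 s.1 + c.2 s.2 ∈ T x} *
      (1 + N * β₁ / (M₀ * M₁) + N * β₂ / M₀) := by
    intro x
    refine (mean_le_prob_exists_pos (B₁ := N * β₁) (B₂ := N * β₂) hU0 hU1 hQ0 hQ1 (hf0 x)
      (by positivity) (by positivity) ?_ ?_ ?_ hM₀ hM₁).trans ?_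
    · intro u v
      refine mul_le_mul_of_nonneg_left ?_ hNpos.le
      by_cases h : (u, v) ∈ A x
      · simpa [h] using h.2.1
      · simpa [h] using hβ₁
    · intro u
      by_cases h : wordProb (subLaw q d) (-x + u) ≤ β₂
      · calc ∑ v, wordProb q v * f x u v ≤ ∑ v, N * (wordProb q v * wordProb d (-x + u + v)) := by
              refine Finset.sum_le_sum fun v _ => ?_
              rw [mul_left_comm]
              exact mul_le_mul_of_nonneg_left (mul_le_mul_of_nonneg_left
                (mul_le_of_le_one_right (hd0 _) (indicator_one_le_one _ _)) (hQ0 v)) hNpos.le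
          _ = N * wordProb (subLaw q d) (-x + u) := by rw [← Finset.mul_sum, wordProb_subLaw]
          _ ≤ N * β₂ := mul_le_mul_of_nonneg_left h hNpos.le
      · have : ∀ v, f x u v = 0 := fun v => by
          have : (u, v) ∉ A x := fun hA => h hA.2.2
          simp [f, this]
        simp only [this, mul_zero, Finset.sum_const_zero]
        positivity
    · intro v
      calc ∑ u, wordProb (uniform G) u * f x u v ≤ ∑ u, wordProb d (-x + u + v) :=
            Finset.sum_le_sum fun u _ => by
              rw [hUN]
              exact mul_le_of_le_one_right (hd0 _) (indicator_one_le_one _ _)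
        _ = 1 := by rw [sum_add_add (-x) v (wordProb d), hds]
    · refine mul_le_mul_of_nonneg_right (prob_mono (fun c => mul_nonneg
        (wordProb_nonneg hU0 _) (wordProb_nonneg hQ0 _)) ?_) (by positivity)
      rintro c - ⟨s, hs⟩
      refine ⟨s, ?_⟩
      by_contra hT
      have : (c.1 s.1, c.2 s.2) ∉ A x := fun hA => hT hA.1
      simp [f, this] at hs
  -- Union bound for leaving `A x`: translation in `u` turns the total weight and the three defects
  -- into the probabilities `e0` to `e3`.
  have hlow : ∀ x, 1 - ∑ w, wordProb d (-x + w) * (T x)ᶜ.indicator 1 w -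
      prob (wordProb d) {e : Fin n → G | β₁ < wordProb d e} -
      prob (wordProb (subLaw q d)) {z : Fin n → G | β₂ < wordProb (subLaw q d) z} ≤
      ∑ u, wordProb (uniform G) u * ∑ v, wordProb q v * f x u v := by
    intro x
    set S₁ := {e : Fin n → G | β₁ < wordProb d e} with hS₁
    set S₂ := {z : Fin n → G | β₂ < wordProb (subLaw q d) z} with hS₂
    have e0 : ∑ u, ∑ v, wordProb q v * wordProb d (-x + u + v) = 1 := by
      rw [Finset.sum_comm]
      simp_rw [← Finset.mul_sum, fun v => sum_add_add (-x) v (wordProb d), hds, mul_one, hQ1]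
    have e1 : ∑ u, ∑ v, wordProb q v * (wordProb d (-x + u + v) *
        (T x)ᶜ.indicator 1 (u + v)) = ∑ w, wordProb d (-x + w) * (T x)ᶜ.indicator 1 w := by
      rw [Finset.sum_comm]
      simp_rw [← Finset.mul_sum, add_assoc]
      have : ∀ v : Fin n → G, ∑ u, wordProb d (-x + (u + v)) *
          (T x)ᶜ.indicator (1 : (Fin n → G) → ℝ) (u + v) =
          ∑ w, wordProb d (-x + w) * (T x)ᶜ.indicator 1 w := fun v =>
        Equiv.sum_comp (Equiv.addRight v) fun w => wordProb d (-x + w) * (T x)ᶜ.indicator 1 w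
      simp_rw [this, ← Finset.sum_mul, hQ1, one_mul]
    have e2 : ∑ u, ∑ v, wordProb q v * (wordProb d (-x + u + v) *
        S₁.indicator 1 (-x + u + v)) = prob (wordProb d) S₁ := by
      rw [Finset.sum_comm]
      simp_rw [← Finset.mul_sum,
        fun v => sum_add_add (-x) v fun e => wordProb d e * S₁.indicator 1 e]
      rw [← Finset.sum_mul, hQ1, one_mul, prob]
    have e3 : ∑ u, ∑ v, wordProb q v * (wordProb d (-x + u + v) *
        S₂.indicator 1 (-x + u)) = prob (wordProb (subLaw q d)) S₂ := by
      simp_rw [← mul_assoc, ← Finset.sum_mul, ← wordProb_subLaw]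
      exact Equiv.sum_comp (Equiv.addLeft (-x)) fun z => wordProb (subLaw q d) z * S₂.indicator 1 z
    rw [← e0, ← e1, ← e2, ← e3]
    simp_rw [← Finset.sum_sub_distrib, Finset.mul_sum]
    refine Finset.sum_le_sum fun u _ => Finset.sum_le_sum fun v _ => ?_
    rw [mul_left_comm (wordProb (uniform G) u), hUN, ← mul_sub, ← mul_sub, ← mul_sub]
    refine mul_le_mul_of_nonneg_left ?_ (hQ0 v)
    have h0 := hd0 (-x + u + v)
    rw [show ∀ a b c e : ℝ, a - a * b - a * c - a * e = a * (1 - b - c - e) by intros; ring]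
    refine mul_le_mul_of_nonneg_left ?_ h0
    by_cases h1 : u + v ∈ T x
    · by_cases h2 : -x + u + v ∈ S₁
      · have := indicator_one_nonneg (A x) (u, v)
        have := indicator_one_nonneg S₂ (-x + u)
        simp only [Set.indicator_of_mem h2, Pi.one_apply]
        have := indicator_one_nonneg (T x)ᶜ (u + v)
        linarith
      · by_cases h3 : -x + u ∈ S₂
        · have := indicator_one_nonneg (A x) (u, v)
          have := indicator_one_nonneg S₁ (-x + u + v)
          simp only [Set.indicator_of_mem h3, Pi.one_apply]
          have := indicator_one_nonneg (T x)ᶜ (u + v)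
          linarith
        · have hA : (u, v) ∈ A x := ⟨h1, not_lt.1 h2, not_lt.1 h3⟩
          simp [h1, h2, h3, hA]
    · have h1' : u + v ∈ (T x)ᶜ := h1
      have := indicator_one_nonneg (A x) (u, v)
      have := indicator_one_nonneg S₁ (-x + u + v)
      have := indicator_one_nonneg S₂ (-x + u)
      rw [Set.indicator_of_mem h1', Pi.one_apply]
      linarith
  have key := Finset.sum_le_sum fun (x : Fin n → G) (_ : x ∈ Finset.univ) =>
    mul_le_mul_of_nonneg_left ((hlow x).trans (hx x)) (hU0 x)
  simp_rw [← mul_assoc] at key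
  rw [← Finset.sum_mul] at key
  refine le_trans (le_of_eq ?_) key
  simp_rw [mul_sub, Finset.sum_sub_distrib, ← Finset.sum_mul, hU1, one_mul]
  rw [prob_wordProb_prod (uniform G) d fun x => (T x)ᶜ]

/-- Probability that no sum of two codewords falls in the set `T x` attached to the source word. -/
noncomputable def uncoveredProb (q : G → ℝ) {n : ℕ} (M₀ M₁ : ℕ)
    (T : (Fin n → G) → Set (Fin n → G)) : ℝ :=
  ∑ x, wordProb (uniform G) x * prob (codePairProb (wordProb (uniform G)) (wordProb q))
    {c : Code G n M₀ × Code G n M₁ | ¬∃ s : Fin M₀ × Fin M₁, c.1 s.1 + c.2 s.2 ∈ T x}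

theorem uncoveredProb_nonneg {q : G → ℝ} (hq : ∀ g, 0 ≤ q g) {n M₀ M₁ : ℕ}
    (T : (Fin n → G) → Set (Fin n → G)) : 0 ≤ uncoveredProb q M₀ M₁ T :=
  Finset.sum_nonneg fun _ _ => mul_nonneg (wordProb_nonneg (uniform_nonneg G) _) <|
    prob_nonneg (fun _ => mul_nonneg (wordProb_nonneg (wordProb_nonneg (uniform_nonneg G)) _)
      (wordProb_nonneg (wordProb_nonneg hq) _)) _

theorem uncoveredProb_eq {q : G → ℝ} (hq1 : ∑ g, q g = 1) {n M₀ M₁ : ℕ}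
    (T : (Fin n → G) → Set (Fin n → G)) :
    uncoveredProb q M₀ M₁ T = 1 - ∑ x, wordProb (uniform G) x *
      prob (codePairProb (wordProb (uniform G)) (wordProb q))
        {c : Code G n M₀ × Code G n M₁ |
          ∃ s : Fin M₀ × Fin M₁, c.1 s.1 + c.2 s.2 ∈ T x} := by
  have h1 : ∑ c : Code G n M₀ × Code G n M₁,
      codePairProb (wordProb (uniform G)) (wordProb q) c = 1 :=
    sum_codePairProb (sum_wordProb (sum_uniform G)) (sum_wordProb hq1)
  rw [← sum_wordProb (n := n) (sum_uniform G), ← Finset.sum_sub_distrib]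
  refine Finset.sum_congr rfl fun x _ => ?_
  rw [← mul_one_sub, ← prob_compl h1]
  rfl

/-- Asymptotic covering: if the test channel with noise `d` hits `T` with probability tending to
one and the rates are large enough, then some sum of codewords hits `T`. -/
theorem tendsto_uncoveredProb {q d : G → ℝ} (hq : ∀ g, 0 ≤ q g) (hq1 : ∑ g, q g = 1)
    (hd : ∀ g, 0 ≤ d g) (hd1 : ∑ g, d g = 1)
    {T : ∀ n, (Fin n → G) → Set (Fin n → G)}
    (hT : Tendsto (fun n => prob (wordProb fun a : G × G => uniform G a.1 * d (-a.1 + a.2))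
      {ω : Fin n → G × G | (fun k => (ω k).2) ∈ (T n fun k => (ω k).1)ᶜ}) atTop (𝓝 0))
    {R₀ R₁ : ℝ} {M₀ M₁ : ℕ → ℕ} (hM₀ : HasRate M₀ R₀) (hM₁ : HasRate M₁ R₁)
    (hR₀ : Real.logb 2 (Fintype.card G) - entropy (subLaw q d) < R₀)
    (hR : Real.logb 2 (Fintype.card G) - entropy d < R₀ + R₁) :
    Tendsto (fun n => uncoveredProb q (M₀ n) (M₁ n) (T n)) atTop (𝓝 0) := by
  obtain ⟨c₀, hc₀, hc₀R⟩ := exists_between hR₀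
  obtain ⟨c, hc, hcR⟩ := exists_between hR
  set L := Real.logb 2 (Fintype.card G) with hL
  -- The threshold `β = 2 ^ (-(n * (H - δ)))` with `δ = c - (L - H)` is chosen so that `|G| ^ n * β`
  -- is exactly `2 ^ (n * c)`.
  have hpow : ∀ (n : ℕ) (c H : ℝ), (Fintype.card G : ℝ) ^ n * 2 ^ (-(n * (H - (c - (L - H))))) =
      (2 : ℝ) ^ (n * c) := by
    intro n c H
    have hG : (Fintype.card G : ℝ) = 2 ^ L :=
      (Real.rpow_logb two_pos (by norm_num) (card_pos_real G)).symm
    rw [hG, ← Real.rpow_natCast, ← Real.rpow_mul two_pos.le, ← Real.rpow_add two_pos]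
    ring_nf
  have h1 := tendsto_prob_rpow_lt_wordProb hd hd1 (sub_pos.2 hc)
  have h2 := tendsto_prob_rpow_lt_wordProb (subLaw_nonneg hq hd) (sum_subLaw hq1 hd1)
    (sub_pos.2 hc₀)
  have h3 := (hM₀.mul hM₁).tendsto_rpow_div hcR
  have h4 := hM₀.tendsto_rpow_div hc₀R
  have hnum := ((tendsto_const_nhds (x := (1 : ℝ))).sub hT |>.sub h1 |>.sub h2)
  have hden := ((tendsto_const_nhds (x := (1 : ℝ))).add h3 |>.add h4)
  have hquot := hnum.div hden (by norm_num)
  have hlim := (tendsto_const_nhds (x := (1 : ℝ))).sub hquot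
  norm_num at hlim
  refine squeeze_zero (fun n => uncoveredProb_nonneg hq _) (fun n => ?_) hlim
  rw [uncoveredProb_eq hq1]
  refine sub_le_sub_left ?_ _
  have hm₀ := hM₀.1 n
  have hm₁ := hM₁.1 n
  have hden_pos : (0 : ℝ) < 1 + 2 ^ (n * c) / (M₀ n * M₁ n) + 2 ^ (n * c₀) / M₀ n := by
    positivity
  rw [div_le_iff₀ hden_pos]
  have := one_sub_le_prob_exists_mul hq hq1 hd hd1 (T n)
    (Real.rpow_pos_of_pos two_pos (-(n * (entropy d - (c - (L - entropy d)))))).le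
    (Real.rpow_pos_of_pos two_pos
      (-(n * (entropy (subLaw q d) - (c₀ - (L - entropy (subLaw q d))))))).le hm₀ hm₁
  rw [hpow, hpow] at this
  exact this

end Covering

/-! ### The symmetric test channel. -/

section TestChannel

variable {G : Type*} [AddGroup G] [Fintype G]

theorem sourceLaw_eq_uniform {p : G → ℝ} (hp1 : ∑ g, p g = 1) : sourceLaw p = uniform G := by
  funext g
  have h : ∑ a, p (-a + g) = ∑ a, p a :=
    Equiv.sum_comp ((Equiv.neg G).trans (Equiv.addRight g)) p
  simp only [sourceLaw, conv, uniform]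
  rw [← Finset.mul_sum, h, hp1, mul_one]

theorem entropy_uniform (G : Type*) [AddGroup G] [Fintype G] :
    entropy (uniform G) = Real.logb 2 (Fintype.card G) := by
  have := (card_pos_real G).ne'
  simp only [entropy, uniform, Real.negMulLog, Finset.sum_const, Finset.card_univ, nsmul_eq_mul,
    Real.logb, one_div, Real.log_inv]
  field_simp

/-- For even `d` the two laws are reflections of each other under `g ↦ -g`, also when `G` is not
commutative. -/
theorem entropy_subLaw (q : G → ℝ) {d : G → ℝ} (hd : ∀ g, d (-g) = d g) :
    entropy (subLaw q d) = entropy (conv q d) := by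
  have h : ∀ g, subLaw q d g = conv q d (-g) := fun g =>
    Finset.sum_congr rfl fun c _ => by rw [← hd, neg_add_rev]
  simp only [entropy, h]
  exact Equiv.sum_comp (Equiv.neg G) fun g => Real.negMulLog (conv q d g) / Real.log 2

variable [DecidableEq G]

theorem distortionLaw_neg (D : ℝ) (g : G) : distortionLaw G D (-g) = distortionLaw G D g := by
  simp [distortionLaw]

theorem distortionLaw_nonneg {D : ℝ} (hD0 : 0 ≤ D) (hD1 : D ≤ 1) (g : G) :
    0 ≤ distortionLaw G D g := by
  have hG : (1 : ℝ) ≤ Fintype.card G := Nat.one_le_cast.2 Fintype.card_pos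
  unfold distortionLaw
  split_ifs
  · linarith
  · exact div_nonneg hD0 (by linarith)

theorem sum_distortionLaw_mul_ite (hG : 2 ≤ Fintype.card G) (D A B : ℝ) :
    ∑ g : G, distortionLaw G D g * (if g = 0 then A else B) = (1 - D) * A + D * B := by
  have hG' : (2 : ℝ) ≤ Fintype.card G := by exact_mod_cast hG
  rw [← Finset.add_sum_erase _ _ (Finset.mem_univ (0 : G))]
  have h : ∀ g ∈ Finset.univ.erase (0 : G), distortionLaw G D g * (if g = 0 then A else B) =
      D / ((Fintype.card G : ℝ) - 1) * B := by
    intro g hg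
    simp [distortionLaw, Finset.ne_of_mem_erase hg]
  rw [Finset.sum_congr rfl h, Finset.sum_const, Finset.card_erase_of_mem (Finset.mem_univ _),
    Finset.card_univ, nsmul_eq_mul, Nat.cast_sub (by omega)]
  have : (Fintype.card G : ℝ) - 1 ≠ 0 := by linarith
  simp [distortionLaw]
  field_simp

theorem sum_distortionLaw (hG : 2 ≤ Fintype.card G) (D : ℝ) :
    ∑ g : G, distortionLaw G D g = 1 := by
  simpa using sum_distortionLaw_mul_ite hG D 1 1

theorem continuous_distortionLaw (g : G) : Continuous fun D => distortionLaw G D g := by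
  unfold distortionLaw
  split_ifs <;> fun_prop

theorem continuous_entropy_distortionLaw : Continuous fun D => entropy (distortionLaw G D) := by
  unfold entropy
  exact continuous_finsetSum _ fun g _ =>
    (Real.continuous_negMulLog.comp (continuous_distortionLaw g)).div_const _

theorem continuous_entropy_conv_distortionLaw (q : G → ℝ) :
    Continuous fun D => entropy (conv q (distortionLaw G D)) := by
  unfold entropy conv
  exact continuous_finsetSum _ fun g _ => (Real.continuous_negMulLog.comp
    (continuous_finsetSum _ fun a _ => continuous_const.mul (continuous_distortionLaw _))).div_const _

theorem testLaw_eq {p : G → ℝ} (hp1 : ∑ g, p g = 1) (D : ℝ) :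
    testLaw p D = fun a => uniform G a.1 * distortionLaw G D (-a.1 + a.2) := by
  simp only [← sourceLaw_eq_uniform hp1]
  rfl

theorem testLaw_nonneg {p : G → ℝ} (hp1 : ∑ g, p g = 1) {D : ℝ} (hD0 : 0 ≤ D) (hD1 : D ≤ 1)
    (a : G × G) : 0 ≤ testLaw p D a := by
  rw [testLaw_eq hp1]
  exact mul_nonneg (uniform_nonneg G _) (distortionLaw_nonneg hD0 hD1 _)

theorem sum_testLaw_mul_ite {p : G → ℝ} (hp1 : ∑ g, p g = 1) (hG : 2 ≤ Fintype.card G)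
    (D A B : ℝ) :
    ∑ a : G × G, testLaw p D a * (if a.1 = a.2 then A else B) = (1 - D) * A + D * B := by
  rw [testLaw_eq hp1, Fintype.sum_prod_type]
  have h : ∀ x : G, ∑ w, distortionLaw G D (-x + w) * (if x = w then A else B) =
      (1 - D) * A + D * B := by
    intro x
    rw [← sum_distortionLaw_mul_ite hG]
    refine Eq.trans (Finset.sum_congr rfl fun w _ => ?_) (Equiv.sum_comp (Equiv.addLeft (-x))
      fun g => distortionLaw G D g * if g = 0 then A else B)
    simp [neg_add_eq_zero]
  simp_rw [mul_assoc, ← Finset.mul_sum, h, ← Finset.sum_mul, sum_uniform, one_mul]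

theorem sum_testLaw {p : G → ℝ} (hp1 : ∑ g, p g = 1) (hG : 2 ≤ Fintype.card G) (D : ℝ) :
    ∑ a : G × G, testLaw p D a = 1 := by
  simpa using sum_testLaw_mul_ite hp1 hG D 1 1

theorem continuous_testLaw (p : G → ℝ) (a : G × G) : Continuous fun D => testLaw p D a :=
  continuous_const.mul (continuous_distortionLaw _)

end TestChannel

/-! ### Joint typicality of i.i.d. pairs. -/

section Typicality

variable {α : Type*} [DecidableEq α]

theorem pairCount_eq_sum {n : ℕ} (ω : Fin n → α × α) (a : α × α) :
    (pairCount (fun k => (ω k).1) (fun k => (ω k).2) a : ℝ) =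
      ∑ k, if ω k = a then 1 else 0 := by
  simp [pairCount]

theorem hammingDist_eq_sum {n : ℕ} (ω : Fin n → α × α) :
    (hammingDist (fun k => (ω k).1) (fun k => (ω k).2) : ℝ) =
      ∑ k, if (ω k).1 = (ω k).2 then 0 else 1 := by
  simp only [hammingDist, Finset.card_filter, Nat.cast_sum]
  exact Finset.sum_congr rfl fun k _ => by by_cases h : (ω k).1 = (ω k).2 <;> simp [h]

theorem hammingDist_div_le_one {n : ℕ} (x w : Fin n → α) : (hammingDist x w : ℝ) / n ≤ 1 := by
  refine div_le_one_of_le₀ ?_ (Nat.cast_nonneg n)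
  exact_mod_cast (hammingDist_le_card_fintype (x := x) (y := w)).trans (by simp)

variable [Fintype α]

theorem hammingDist_eq_sum_pairCount {n : ℕ} (x w : Fin n → α) :
    (hammingDist x w : ℝ) = ∑ a : α × α, if a.1 = a.2 then 0 else (pairCount x w a : ℝ) := by
  rw [show (hammingDist x w : ℝ) = ∑ k, if x k = w k then 0 else 1 from
    hammingDist_eq_sum fun k => (x k, w k)]
  have h : ∀ a : α × α, (if a.1 = a.2 then 0 else (pairCount x w a : ℝ)) =
      ∑ k, if (x k, w k) = a then (if a.1 = a.2 then 0 else 1) else 0 := by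
    intro a
    by_cases ha : a.1 = a.2
    · simp [ha]
    · simp [ha, pairCount]
  simp_rw [h]
  rw [Finset.sum_comm]
  simp

/-- Words drawn i.i.d. from a law close to `J` are jointly typical with high probability. -/
theorem tendsto_prob_not_jointlyTypical {P J : α × α → ℝ} (hP : ∀ a, 0 ≤ P a)
    (hP1 : ∑ a, P a = 1) {ε : ℝ}
    (hclose : ∀ a, |P a - J a| < ε / (Fintype.card α : ℝ) ^ 2) (hzero : ∀ a, J a = 0 → P a = 0) :
    Tendsto (fun n => prob (wordProb P) {ω : Fin n → α × α |
      ¬JointlyTypical J ε (fun k => (ω k).1) (fun k => (ω k).2)}) atTop (𝓝 0) := by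
  have hlim := tendsto_finsetSum Finset.univ fun (a : α × α) _ =>
    tendsto_prob_mean_notMem hP hP1 (fun b => if b = a then 1 else 0)
      (U := Metric.ball (J a) (ε / (Fintype.card α : ℝ) ^ 2))
      (Metric.isOpen_ball.mem_nhds (by simpa [Real.dist_eq] using hclose a))
  rw [Finset.sum_const_zero] at hlim
  refine squeeze_zero (fun n => prob_nonneg (wordProb_nonneg hP) _) (fun n => ?_) hlim
  refine (prob_mono (wordProb_nonneg hP) fun ω hω0 hω => ?_).trans
    (prob_iUnion_le (wordProb_nonneg hP) _)
  by_contra hmem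
  refine hω fun a => ⟨fun _ => ?_, fun ha => ?_⟩
  · by_contra hlt
    refine hmem (Set.mem_iUnion.2 ⟨a, fun hball => hlt ?_⟩)
    rw [Metric.mem_ball, Real.dist_eq, ← pairCount_eq_sum] at hball
    exact hball
  -- A forbidden pair would make the probability of the word zero.
  · rw [pairCount, Finset.card_eq_zero, Finset.filter_eq_empty_iff]
    intro k _ hk
    exact Finset.prod_ne_zero_iff.1 hω0 k (Finset.mem_univ k)
      ((congrArg P (show ω k = a from hk)).trans (hzero a ha))

end Typicality

/-! ### Distortion of typical pairs. -/

section Distortion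

variable {G : Type*} [AddGroup G] [Fintype G] [DecidableEq G] {p : G → ℝ}

/-- The off-diagonal mass is at most `D`, and the `|G|²` deviations of at most `ε / |G|²` add up to
`ε`. -/
theorem JointlyTypical.hammingDist_le (hp1 : ∑ g, p g = 1) (hG : 2 ≤ Fintype.card G) {D ε : ℝ}
    (hD0 : 0 ≤ D) (hD1 : D ≤ 1) (hε : 0 ≤ ε) {n : ℕ} {x w : Fin n → G}
    (h : JointlyTypical (testLaw p D) ε x w) : (hammingDist x w : ℝ) / n ≤ D + ε := by
  have hN := (card_pos_real G).ne'
  have h1 : ∀ a : G × G, (if a.1 = a.2 then 0 else (pairCount x w a : ℝ)) / n ≤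
      testLaw p D a * (if a.1 = a.2 then 0 else 1) + ε / (Fintype.card G : ℝ) ^ 2 := by
    intro a
    by_cases ha : a.1 = a.2
    · simp only [ha, if_true, zero_div, mul_zero, zero_add]
      positivity
    · simp only [ha, if_false, mul_one]
      rcases (testLaw_nonneg hp1 hD0 hD1 a).eq_or_lt with h0 | hpos
      · rw [(h a).2 h0.symm, ← h0]
        simp only [Nat.cast_zero, zero_div, zero_add]
        positivity
      · have := (abs_lt.1 ((h a).1 hpos)).2
        linarith
  rw [hammingDist_eq_sum_pairCount, Finset.sum_div]
  refine (Finset.sum_le_sum fun a _ => h1 a).trans (le_of_eq ?_)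
  rw [Finset.sum_add_distrib, sum_testLaw_mul_ite hp1 hG]
  simp
  field_simp

/-- At level zero all off-diagonal pairs have probability zero, hence never occur. -/
theorem JointlyTypical.hammingDist_eq_zero {ε : ℝ} {n : ℕ} {x w : Fin n → G}
    (h : JointlyTypical (testLaw p 0) ε x w) : (hammingDist x w : ℝ) = 0 := by
  rw [hammingDist_eq_sum_pairCount]
  refine Finset.sum_eq_zero fun a _ => ?_
  by_cases ha : a.1 = a.2
  · simp [ha]
  · rw [if_neg ha, (h a).2, Nat.cast_zero]
    have : -a.1 + a.2 ≠ 0 := fun h0 => ha (neg_add_eq_zero.1 h0)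
    simp [testLaw, distortionLaw, this]

end Distortion

/-! ### Error probability of typical encoders. -/

section Encoders

variable {G : Type*} [AddGroup G] [Fintype G] [DecidableEq G] {p q : G → ℝ}

theorem encoderErrorProb_nonneg (hp : ∀ g, 0 ≤ p g) (hq : ∀ g, 0 ≤ q g) {n M₀ M₁ : ℕ}
    {enc : Encoder G n M₀ M₁} (henc : ∀ c₀ c₁ x, enc c₀ c₁ x ∈ stdSimplex ℝ (Fin M₀ × Fin M₁))
    (t : ℝ) : 0 ≤ encoderErrorProb p q enc t := by
  have hU := uniform_nonneg G
  refine Finset.sum_nonneg fun y _ => Finset.sum_nonneg fun z _ => Finset.sum_nonneg fun c₀ _ =>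
    Finset.sum_nonneg fun c₁ _ => mul_nonneg (mul_nonneg (mul_nonneg (mul_nonneg
      (wordProb_nonneg hU _) (wordProb_nonneg hp _))
      (wordProb_nonneg (P := wordProb _) (wordProb_nonneg hU) c₀))
      (wordProb_nonneg (P := wordProb _) (wordProb_nonneg hq) c₁))
      (Finset.sum_nonneg fun s _ => ?_)
  split_ifs
  · exact (henc c₀ c₁ _).1 s
  · exact le_rfl

/-- An encoder that meets the constraint whenever the target set is hit errs at most as often as
the target set is missed. -/
theorem encoderErrorProb_le_uncoveredProb (hp1 : ∑ g, p g = 1)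
    (hq : ∀ g, 0 ≤ q g) {n M₀ M₁ : ℕ} {enc : Encoder G n M₀ M₁}
    (henc : ∀ c₀ c₁ x, enc c₀ c₁ x ∈ stdSimplex ℝ (Fin M₀ × Fin M₁)) {t : ℝ}
    (T : (Fin n → G) → Set (Fin n → G))
    (hT : ∀ c₀ c₁ x, (∃ s : Fin M₀ × Fin M₁, c₀ s.1 + c₁ s.2 ∈ T x) →
      ∀ s, enc c₀ c₁ x s ≠ 0 → (hammingDist x (c₀ s.1 + c₁ s.2) : ℝ) / n ≤ t) :
    encoderErrorProb p q enc t ≤ uncoveredProb q M₀ M₁ T := by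
  have hU := uniform_nonneg G
  let g : (Fin n → G) → ℝ := fun x => ∑ c₀ : Code G n M₀, ∑ c₁ : Code G n M₁,
    codeProb (uniform G) c₀ * codeProb q c₁ * ∑ s : Fin M₀ × Fin M₁,
      if t < (hammingDist x (c₀ s.1 + c₁ s.2) : ℝ) / n then enc c₀ c₁ x s else 0
  -- Equal word probabilities let the weight of `y` be read as that of `x = y + z`, so `z` can be
  -- summed out.
  have hUc : ∀ x y : Fin n → G, wordProb (uniform G) x = wordProb (uniform G) y :=
    fun x y => by simp [wordProb, uniform]
  have hE : encoderErrorProb p q enc t = ∑ x, wordProb (uniform G) x * g x := by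
    have h1 : encoderErrorProb p q enc t =
        ∑ y, ∑ z, wordProb p z * (wordProb (uniform G) (y + z) * g (y + z)) := by
      refine Finset.sum_congr rfl fun y _ => Finset.sum_congr rfl fun z _ => ?_
      rw [hUc (y + z) y]
      simp only [g, Finset.mul_sum]
      refine Finset.sum_congr rfl fun c₀ _ => Finset.sum_congr rfl fun c₁ _ =>
        Finset.sum_congr rfl fun s _ => by ring
    rw [h1, Finset.sum_comm]
    have h2 : ∀ z : Fin n → G, ∑ y, wordProb (uniform G) (y + z) * g (y + z) =
        ∑ x, wordProb (uniform G) x * g x := fun z =>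
      Equiv.sum_comp (Equiv.addRight z) fun x => wordProb (uniform G) x * g x
    simp_rw [← Finset.mul_sum, h2, ← Finset.sum_mul, sum_wordProb hp1, one_mul]
  rw [hE]
  refine Finset.sum_le_sum fun x _ => mul_le_mul_of_nonneg_left ?_ (wordProb_nonneg hU x)
  rw [prob, Fintype.sum_prod_type]
  refine Finset.sum_le_sum fun c₀ _ => Finset.sum_le_sum fun c₁ _ => ?_
  refine mul_le_mul_of_nonneg_left ?_ (mul_nonneg
    (wordProb_nonneg (P := wordProb _) (wordProb_nonneg hU) c₀)
    (wordProb_nonneg (P := wordProb _) (wordProb_nonneg hq) c₁))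
  by_cases h : ∃ s : Fin M₀ × Fin M₁, c₀ s.1 + c₁ s.2 ∈ T x
  · refine le_trans (le_of_eq ?_) (indicator_one_nonneg _ _)
    refine Finset.sum_eq_zero fun s _ => ?_
    split_ifs with hlt
    · by_contra h0
      exact absurd hlt (not_lt.2 (hT c₀ c₁ x h s h0))
    · rfl
  · rw [Set.indicator_of_mem (by exact h), Pi.one_apply, ← (henc c₀ c₁ x).2]
    refine Finset.sum_le_sum fun s _ => ?_
    split_ifs
    · exact le_rfl
    · exact (henc c₀ c₁ x).1 s

theorem uniform_mem_stdSimplex (α : Type*) [Fintype α] [Nonempty α] :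
    uniform α ∈ stdSimplex ℝ α := by
  refine ⟨uniform_nonneg α, ?_⟩
  have : (Fintype.card α : ℝ) ≠ 0 := Nat.cast_ne_zero.2 Fintype.card_ne_zero
  simp [uniform, this]

/-- There is a typical encoder that gives priority to the typical pairs enjoying a further
property `Good`. -/
theorem exists_isTypicalEncoder (J : G × G → ℝ) (ε : ℝ) {n M₀ M₁ : ℕ} (hM₀ : 0 < M₀)
    (hM₁ : 0 < M₁) (Good : (Fin n → G) → (Fin n → G) → Prop) :
    ∃ enc : Encoder G n M₀ M₁, IsTypicalEncoder J ε enc ∧ ∀ c₀ c₁ x,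
      (∃ s : Fin M₀ × Fin M₁, JointlyTypical J ε x (c₀ s.1 + c₁ s.2) ∧
        Good x (c₀ s.1 + c₁ s.2)) →
      ∀ s, enc c₀ c₁ x s ≠ 0 → Good x (c₀ s.1 + c₁ s.2) := by
  have : Nonempty (Fin M₀ × Fin M₁) := ⟨(⟨0, hM₀⟩, ⟨0, hM₁⟩)⟩
  have key : ∀ (c₀ : Code G n M₀) (c₁ : Code G n M₁) (x : Fin n → G),
      ∃ e : Fin M₀ × Fin M₁ → ℝ, e ∈ stdSimplex ℝ (Fin M₀ × Fin M₁) ∧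
        ((∃ s : Fin M₀ × Fin M₁, JointlyTypical J ε x (c₀ s.1 + c₁ s.2)) →
          ∀ s, e s ≠ 0 → JointlyTypical J ε x (c₀ s.1 + c₁ s.2)) ∧
        ((¬∃ s : Fin M₀ × Fin M₁, JointlyTypical J ε x (c₀ s.1 + c₁ s.2)) →
          e = uniform (Fin M₀ × Fin M₁)) ∧
        ((∃ s : Fin M₀ × Fin M₁, JointlyTypical J ε x (c₀ s.1 + c₁ s.2) ∧
          Good x (c₀ s.1 + c₁ s.2)) → ∀ s, e s ≠ 0 → Good x (c₀ s.1 + c₁ s.2)) := by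
    intro c₀ c₁ x
    have hsingle : ∀ s₀ s : Fin M₀ × Fin M₁,
        (Pi.single s₀ 1 : Fin M₀ × Fin M₁ → ℝ) s ≠ 0 → s = s₀ := fun s₀ s h => by
      by_contra hne
      exact h (Pi.single_eq_of_ne hne 1)
    by_cases hgood : ∃ s : Fin M₀ × Fin M₁, JointlyTypical J ε x (c₀ s.1 + c₁ s.2) ∧
        Good x (c₀ s.1 + c₁ s.2)
    · obtain ⟨s₀, ht, hg⟩ := hgood
      exact ⟨Pi.single s₀ 1, single_mem_stdSimplex ℝ s₀,
        fun _ s hs => by rwa [hsingle s₀ s hs], fun h => absurd ⟨s₀, ht⟩ h,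
        fun _ s hs => by rwa [hsingle s₀ s hs]⟩
    by_cases htyp : ∃ s : Fin M₀ × Fin M₁, JointlyTypical J ε x (c₀ s.1 + c₁ s.2)
    · obtain ⟨s₀, ht⟩ := htyp
      exact ⟨Pi.single s₀ 1, single_mem_stdSimplex ℝ s₀,
        fun _ s hs => by rwa [hsingle s₀ s hs], fun h => absurd ⟨s₀, ht⟩ h,
        fun h => absurd h hgood⟩
    · exact ⟨uniform _, uniform_mem_stdSimplex _, fun h => absurd h htyp, fun _ => rfl,
        fun h => absurd h hgood⟩
  choose enc hlaw htyp hfall hgood using key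
  exact ⟨enc, ⟨hlaw, htyp, hfall⟩, hgood⟩

end Encoders

/-! ### Rate-distortion function of the uniform source. -/

section RateDistortion

/-- Gibbs' inequality. -/
theorem sum_negMulLog_le {β : Type*} [Fintype β] {J K : β → ℝ} (hJ : ∀ b, 0 ≤ J b)
    (hK : ∀ b, 0 ≤ K b) (hac : ∀ b, K b = 0 → J b = 0) (hsum : ∑ b, K b ≤ ∑ b, J b) :
    ∑ b, Real.negMulLog (J b) ≤ ∑ b, J b * -Real.log (K b) := by
  have h : ∀ b, Real.negMulLog (J b) ≤ J b * -Real.log (K b) + (K b - J b) := by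
    intro b
    rcases (hJ b).eq_or_lt with h0 | hpos
    · simpa [← h0] using hK b
    have hKpos : 0 < K b := (hK b).lt_of_ne' fun h0 => hpos.ne' (hac b h0)
    have hlog := mul_le_mul_of_nonneg_left
      (Real.log_le_sub_one_of_pos (div_pos hKpos hpos)) hpos.le
    rw [Real.log_div hKpos.ne' hpos.ne', mul_sub, mul_sub, mul_div_cancel₀ _ hpos.ne'] at hlog
    rw [Real.negMulLog]
    linarith
  have := Finset.sum_le_sum fun b (_ : b ∈ Finset.univ) => h b
  rw [Finset.sum_add_distrib, Finset.sum_sub_distrib] at this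
  linarith

variable {G : Type*} [AddGroup G] [Fintype G] [DecidableEq G] {p : G → ℝ}

theorem entropy_testLaw (hp1 : ∑ g, p g = 1) (hG : 2 ≤ Fintype.card G) (D : ℝ) :
    entropy (testLaw p D) = entropy (sourceLaw p) + entropy (distortionLaw G D) := by
  have h1 : ∀ x : G, ∑ w, distortionLaw G D (-x + w) = 1 := fun x =>
    (Equiv.sum_comp (Equiv.addLeft (-x)) _).trans (sum_distortionLaw hG D)
  have h2 : ∀ x : G, ∑ w, Real.negMulLog (distortionLaw G D (-x + w)) =
      ∑ w, Real.negMulLog (distortionLaw G D w) := fun x =>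
    Equiv.sum_comp (Equiv.addLeft (-x)) fun w => Real.negMulLog (distortionLaw G D w)
  rw [testLaw_eq hp1, sourceLaw_eq_uniform hp1]
  simp only [entropy, ← Finset.sum_div, ← add_div]
  congr 1
  rw [Fintype.sum_prod_type]
  simp_rw [Real.negMulLog_mul, Finset.sum_add_distrib, ← Finset.sum_mul, ← Finset.mul_sum, h1, h2,
    one_mul, ← Finset.sum_mul, sum_uniform, one_mul]

theorem sum_testLaw_fst (hG : 2 ≤ Fintype.card G) (D : ℝ) (a : G) :
    ∑ b, testLaw p D (a, b) = sourceLaw p a := by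
  have : ∑ b, distortionLaw G D (-a + b) = 1 :=
    (Equiv.sum_comp (Equiv.addLeft (-a)) _).trans (sum_distortionLaw hG D)
  simp only [testLaw, ← Finset.mul_sum, this, mul_one]

theorem sum_distortionLaw_neg_add (hG : 2 ≤ Fintype.card G) (D : ℝ) (b : G) :
    ∑ a, distortionLaw G D (-a + b) = 1 :=
  (Equiv.sum_comp ((Equiv.neg G).trans (Equiv.addRight b)) _).trans (sum_distortionLaw hG D)

theorem sum_testLaw_snd (hp1 : ∑ g, p g = 1) (hG : 2 ≤ Fintype.card G) (D : ℝ) (b : G) :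
    ∑ a, testLaw p D (a, b) = sourceLaw p b := by
  rw [testLaw_eq hp1, sourceLaw_eq_uniform hp1]
  simp only [uniform, ← Finset.mul_sum, sum_distortionLaw_neg_add hG, mul_one]

theorem mutualInfo_testLaw (hp1 : ∑ g, p g = 1) (hG : 2 ≤ Fintype.card G) (D : ℝ) :
    mutualInfo (testLaw p D) = entropy (sourceLaw p) - entropy (distortionLaw G D) := by
  simp only [mutualInfo, sum_testLaw_fst hG, sum_testLaw_snd hp1 hG, entropy_testLaw hp1 hG]
  ring

theorem log_two_mul_entropy_distortionLaw (hG : 2 ≤ Fintype.card G) (D : ℝ) :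
    entropy (distortionLaw G D) * Real.log 2 =
      (1 - D) * -Real.log (1 - D) + D * -Real.log (D / ((Fintype.card G : ℝ) - 1)) := by
  rw [log_two_mul_entropy, ← sum_distortionLaw_mul_ite hG]
  refine Finset.sum_congr rfl fun g _ => ?_
  unfold distortionLaw
  split_ifs <;> rfl

/-- Fano-type inequality: the conditional entropy of a pair of group elements that differ with
probability at most `D` is at most the entropy of the symmetric noise of level `D`. -/
theorem entropy_le_add_entropy_distortionLaw (hG : 2 ≤ Fintype.card G) {D : ℝ} (hD0 : 0 ≤ D)
    (hD : D ≤ 1 - 1 / (Fintype.card G : ℝ)) {J : G × G → ℝ} (hJ : J ∈ stdSimplex ℝ (G × G))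
    (hJD : (∑ a : G × G, if a.1 ≠ a.2 then J a else 0) ≤ D) :
    entropy J ≤ entropy (fun b => ∑ a, J (a, b)) + entropy (distortionLaw G D) := by
  have hN : (2 : ℝ) ≤ Fintype.card G := by exact_mod_cast hG
  have hNpos := card_pos_real G
  have hl2 := Real.log_pos one_lt_two
  have hD1 : D < 1 := by
    have : (0 : ℝ) < 1 / (Fintype.card G : ℝ) := by positivity
    linarith
  obtain ⟨hJ0, hJ1⟩ := hJ
  set Q : G → ℝ := fun b => ∑ a, J (a, b) with hQ
  set δ := ∑ a : G × G, if a.1 ≠ a.2 then J a else 0 with hδ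
  have hδ0 : 0 ≤ δ := Finset.sum_nonneg fun a _ => by
    split_ifs
    · exact hJ0 a
    · exact le_rfl
  have hQ0 : ∀ b, 0 ≤ Q b := fun b => Finset.sum_nonneg fun a _ => hJ0 _
  have hQ1 : ∑ b, Q b = 1 := by rw [← hJ1, Fintype.sum_prod_type_right]
  have hzero : D = 0 → ∀ a : G × G, a.1 ≠ a.2 → J a = 0 := by
    intro h0 a ha
    have h := (Finset.sum_eq_zero_iff_of_nonneg (s := Finset.univ)
      (f := fun a : G × G => if a.1 ≠ a.2 then J a else 0) fun a _ => by
        split_ifs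
        · exact hJ0 a
        · exact le_rfl).1 (le_antisymm (hJD.trans h0.le) hδ0) a (Finset.mem_univ a)
    simpa [ha] using h
  have hQac : ∀ a : G × G, Q a.2 = 0 → J a = 0 := fun a h0 =>
    (Finset.sum_eq_zero_iff_of_nonneg fun x _ => hJ0 (x, a.2)).1 h0 a.1 (Finset.mem_univ _)
  have hdac : ∀ a : G × G, distortionLaw G D (-a.1 + a.2) = 0 → J a = 0 := by
    intro a h0
    by_cases ha : a.1 = a.2
    · simp only [distortionLaw, ha, neg_add_cancel, if_true] at h0
      linarith
    · have : -a.1 + a.2 ≠ 0 := fun h => ha (neg_add_eq_zero.1 h)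
      rw [distortionLaw, if_neg this, div_eq_zero_iff] at h0
      exact hzero (h0.resolve_right (by linarith)) a ha
  -- The comparison law keeps the marginal of the second letter and joins it to the first by
  -- symmetric noise of level `D`.
  have hgibbs := sum_negMulLog_le (J := J)
    (K := fun a => Q a.2 * distortionLaw G D (-a.1 + a.2)) hJ0
    (fun a => mul_nonneg (hQ0 _) (distortionLaw_nonneg hD0 hD1.le _))
    (fun a h => (mul_eq_zero.1 h).elim (hQac a) (hdac a))
    (by
      rw [hJ1, Fintype.sum_prod_type_right]
      simp only [← Finset.mul_sum, sum_distortionLaw_neg_add hG, mul_one, hQ1, le_refl])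
  set A := -Real.log (1 - D) with hA
  set B := -Real.log (D / ((Fintype.card G : ℝ) - 1)) with hB
  have hsplit : ∑ a : G × G, J a * -Real.log (Q a.2 * distortionLaw G D (-a.1 + a.2)) =
      ∑ a : G × G, J a * -Real.log (Q a.2) +
        ∑ a : G × G, (J a * A + (if a.1 ≠ a.2 then J a else 0) * (B - A)) := by
    rw [← Finset.sum_add_distrib]
    refine Finset.sum_congr rfl fun a _ => ?_
    by_cases hJa : J a = 0
    · simp [hJa]
    rw [Real.log_mul (fun h => hJa (hQac a h)) (fun h => hJa (hdac a h))]
    by_cases ha : a.1 = a.2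
    · simp [distortionLaw, ha, A]
      ring
    · have : -a.1 + a.2 ≠ 0 := fun h => ha (neg_add_eq_zero.1 h)
      simp [distortionLaw, ha, this, B]
      ring
  have hQlog : ∑ a : G × G, J a * -Real.log (Q a.2) = entropy Q * Real.log 2 := by
    rw [log_two_mul_entropy, Fintype.sum_prod_type_right]
    simp only [← Finset.sum_mul]
    rfl
  have hJlog : ∑ a, Real.negMulLog (J a) = entropy J * Real.log 2 := by
    rw [log_two_mul_entropy]
    exact Finset.sum_congr rfl fun a _ => by rw [Real.negMulLog]; ring
  rw [hsplit, hQlog, hJlog, Finset.sum_add_distrib, ← Finset.sum_mul, ← Finset.sum_mul, hJ1,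
    ← hδ] at hgibbs
  have hdlog := log_two_mul_entropy_distortionLaw (G := G) hG D
  rw [← hA, ← hB] at hdlog
  -- For `D > 0`, `A ≤ B` amounts to `D / (|G| - 1) ≤ 1 - D`, which is the assumption `D ≤ 1 - 1 /
  -- |G|`. For `D = 0` also `δ = 0`.
  have hlin : (δ - D) * (B - A) ≤ 0 := by
    rcases hD0.eq_or_lt with h0 | hpos
    · have : δ - D = 0 := by linarith
      rw [this, zero_mul]
    · refine mul_nonpos_of_nonpos_of_nonneg (by linarith) (sub_nonneg.2 (neg_le_neg ?_))
      refine Real.log_le_log (div_pos hpos (by linarith)) ?_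
      rw [div_le_iff₀ (by linarith)]
      have := mul_le_mul_of_nonneg_right hD hNpos.le
      rw [sub_mul, one_div_mul_cancel hNpos.ne'] at this
      linarith
  refine le_of_mul_le_mul_right ?_ hl2
  linarith

/-- Rate-distortion function of the uniform source under Hamming distortion. -/
theorem isLeast_achievableInfo (hp1 : ∑ g, p g = 1) (hG : 2 ≤ Fintype.card G) {D : ℝ}
    (hD0 : 0 ≤ D) (hD : D ≤ 1 - 1 / (Fintype.card G : ℝ)) :
    IsLeast (achievableInfo (sourceLaw p) D)
      (entropy (sourceLaw p) - entropy (distortionLaw G D)) := by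
  have hD1 : D ≤ 1 := hD.trans (sub_le_self _ (by positivity))
  refine ⟨⟨testLaw p D, ⟨testLaw_nonneg hp1 hD0 hD1, sum_testLaw hp1 hG D⟩, sum_testLaw_fst hG D,
    le_of_eq ?_, (mutualInfo_testLaw hp1 hG D).symm⟩, ?_⟩
  · have := sum_testLaw_mul_ite hp1 hG D 0 1
    simpa [mul_ite] using this
  · rintro I ⟨J, hJ, hmarg, hdist, rfl⟩
    have := entropy_le_add_entropy_distortionLaw hG hD0 hD hJ hdist
    simp only [mutualInfo, hmarg]
    linarith

end RateDistortion

/-! ### Vanishing error probabilities. -/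

section Achievability

variable {G : Type*} [AddGroup G] [Fintype G] [DecidableEq G] {p q : G → ℝ} {D R₀ R₁ : ℝ}
  {M₀ M₁ : ℕ → ℕ}

theorem tendsto_uncoveredProb_of_testLaw (hp1 : ∑ g, p g = 1) (hq : q ∈ stdSimplex ℝ G)
    (hG : 2 ≤ Fintype.card G) (hD0 : 0 ≤ D) (hD1 : D ≤ 1) (hM₀ : HasRate M₀ R₀)
    (hM₁ : HasRate M₁ R₁)
    (hR₀ : Real.logb 2 (Fintype.card G) - entropy (conv q (distortionLaw G D)) < R₀)
    (hR : Real.logb 2 (Fintype.card G) - entropy (distortionLaw G D) < R₀ + R₁)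
    {T : ∀ n, (Fin n → G) → Set (Fin n → G)}
    (hT : Tendsto (fun n => prob (wordProb (testLaw p D))
      {ω : Fin n → G × G | (fun k => (ω k).2) ∉ T n fun k => (ω k).1}) atTop (𝓝 0)) :
    Tendsto (fun n => uncoveredProb q (M₀ n) (M₁ n) (T n)) atTop (𝓝 0) := by
  rw [testLaw_eq hp1] at hT
  refine tendsto_uncoveredProb hq.1 hq.2 (distortionLaw_nonneg hD0 hD1) (sum_distortionLaw hG D)
    hT hM₀ hM₁ ?_ hR
  rwa [entropy_subLaw q (distortionLaw_neg D)]

theorem tendsto_uncoveredProb_jointlyTypical (hp1 : ∑ g, p g = 1) (hq : q ∈ stdSimplex ℝ G)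
    (hG : 2 ≤ Fintype.card G) (hD0 : 0 ≤ D) (hD1 : D ≤ 1) (hM₀ : HasRate M₀ R₀)
    (hM₁ : HasRate M₁ R₁)
    (hR₀ : Real.logb 2 (Fintype.card G) - entropy (conv q (distortionLaw G D)) < R₀)
    (hR : Real.logb 2 (Fintype.card G) - entropy (distortionLaw G D) < R₀ + R₁) {ε : ℝ}
    (hε : 0 < ε) :
    Tendsto (fun n => uncoveredProb q (M₀ n) (M₁ n)
      fun x : Fin n → G => {w | JointlyTypical (testLaw p D) ε x w}) atTop (𝓝 0) := by
  have hN := card_pos_real G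
  refine tendsto_uncoveredProb_of_testLaw hp1 hq hG hD0 hD1 hM₀ hM₁ hR₀ hR ?_
  exact tendsto_prob_not_jointlyTypical (testLaw_nonneg hp1 hD0 hD1) (sum_testLaw hp1 hG D)
    (fun a => by rw [sub_self, abs_zero]; positivity) fun _ h => h

theorem tendsto_encoderErrorProb (hp : p ∈ stdSimplex ℝ G) (hq : q ∈ stdSimplex ℝ G)
    {enc : ∀ n, Encoder G n (M₀ n) (M₁ n)}
    (henc : ∀ n c₀ c₁ x, enc n c₀ c₁ x ∈ stdSimplex ℝ (Fin (M₀ n) × Fin (M₁ n))) {t : ℝ}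
    {T : ∀ n, (Fin n → G) → Set (Fin n → G)}
    (hT : ∀ n c₀ c₁ x, (∃ s : Fin (M₀ n) × Fin (M₁ n), c₀ s.1 + c₁ s.2 ∈ T n x) →
      ∀ s, enc n c₀ c₁ x s ≠ 0 → (hammingDist x (c₀ s.1 + c₁ s.2) : ℝ) / n ≤ t)
    (hlim : Tendsto (fun n => uncoveredProb q (M₀ n) (M₁ n) (T n)) atTop (𝓝 0)) :
    Tendsto (fun n => encoderErrorProb p q (enc n) t) atTop (𝓝 0) :=
  squeeze_zero (fun n => encoderErrorProb_nonneg hp.1 hq.1 (henc n) t)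
    (fun n => encoderErrorProb_le_uncoveredProb hp.2 hq.1 (henc n) (T n) (hT n)) hlim

/-- Some test channel makes it likely that a pair of words is typical at level `D` and meets the
constraint `D` exactly, while still satisfying the strict rate conditions. -/
theorem exists_testLaw_typical_and_le (hp1 : ∑ g, p g = 1) (hG : 2 ≤ Fintype.card G)
    (hD0 : 0 ≤ D) (hD1 : D ≤ 1) {C : Set ℝ} (hC : C ∈ 𝓝 D) {ε : ℝ} (hε : 0 < ε) :
    ∃ D' ∈ C, 0 ≤ D' ∧ D' ≤ 1 ∧ Tendsto (fun n => prob (wordProb (testLaw p D'))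
      {ω : Fin n → G × G | ¬(JointlyTypical (testLaw p D) ε (fun k => (ω k).1) (fun k => (ω k).2) ∧
        (hammingDist (fun k => (ω k).1) (fun k => (ω k).2) : ℝ) / n ≤ D)}) atTop (𝓝 0) := by
  have hN := card_pos_real G
  -- At the endpoints no smaller noise level is needed: typicality at level `0` forces distortion
  -- zero, and the constraint `1` is always met.
  by_cases hend : D = 0 ∨ D = 1
  · refine ⟨D, mem_of_mem_nhds hC, hD0, hD1, ?_⟩
    have hnn := testLaw_nonneg hp1 hD0 hD1
    refine squeeze_zero (fun n => prob_nonneg (wordProb_nonneg hnn) _) (fun n => ?_)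
      (tendsto_prob_not_jointlyTypical hnn (sum_testLaw hp1 hG D) (J := testLaw p D) (ε := ε)
        (fun a => by rw [sub_self, abs_zero]; positivity) fun _ h => h)
    refine prob_mono (wordProb_nonneg hnn) fun ω _ hω ht => hω ⟨ht, ?_⟩
    rcases hend with rfl | rfl
    · rw [ht.hammingDist_eq_zero, zero_div]
    · exact hammingDist_div_le_one _ _
  · have hpos : 0 < D := hD0.lt_of_ne' fun h => hend (Or.inl h)
    have hlt : D < 1 := hD1.lt_of_ne fun h => hend (Or.inr h)
    have hclose : ∀ᶠ D' in 𝓝 D, ∀ a : G × G,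
        |testLaw p D' a - testLaw p D a| < ε / (Fintype.card G : ℝ) ^ 2 :=
      eventually_all.2 fun a => (continuous_testLaw p a).continuousAt.eventually
        (Metric.ball_mem_nhds (testLaw p D a) (show 0 < ε / (Fintype.card G : ℝ) ^ 2 by positivity))
    -- A level just below `D`: the mean distortion is then strictly less than `D`, while the law
    -- stays within the typicality tolerance.
    obtain ⟨D', ⟨⟨hD'C, hD'close⟩, hD'0⟩, hD'D⟩ := ((((show ∀ᶠ D' in 𝓝 D, D' ∈ C from hC).and hclose).and
      (lt_mem_nhds hpos)).filter_mono nhdsWithin_le_nhds |>.and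
        (self_mem_nhdsWithin (s := Set.Iio D))).exists
    have hD'D : D' < D := hD'D
    have hD'0 : 0 < D' := hD'0
    have hD'1 : D' ≤ 1 := (hD'D.trans hlt).le
    have hnn := testLaw_nonneg hp1 hD'0.le hD'1
    refine ⟨D', hD'C, hD'0.le, hD'1, ?_⟩
    have h1 := tendsto_prob_not_jointlyTypical hnn (sum_testLaw hp1 hG D') hD'close
      -- For `0 < D < 1` the test law at level `D` has full support, so no pair is forbidden.
      fun a h0 => by
        have hG' : (2 : ℝ) ≤ Fintype.card G := by exact_mod_cast hG
        have hu : uniform G a.1 ≠ 0 := by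
          rw [uniform]
          positivity
        rw [testLaw_eq hp1] at h0
        have hd := (mul_eq_zero.1 h0).resolve_left hu
        unfold distortionLaw at hd
        split_ifs at hd
        · linarith
        · have := div_pos hpos (show (0 : ℝ) < Fintype.card G - 1 by linarith)
          linarith
    have h2 := tendsto_prob_mean_notMem hnn (sum_testLaw hp1 hG D')
      (fun a => if a.1 = a.2 then 0 else 1) (U := Set.Iic D) (by
        rw [sum_testLaw_mul_ite hp1 hG]
        simpa using Iic_mem_nhds hD'D)
    have hlim := h1.add h2
    rw [add_zero] at hlim
    refine squeeze_zero (fun n => prob_nonneg (wordProb_nonneg hnn) _) (fun n => ?_) hlim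
    refine (prob_mono (wordProb_nonneg hnn) fun ω _ hω => ?_).trans
      (prob_union_le (wordProb_nonneg hnn) _ _)
    by_contra hmem
    refine hω ⟨by_contra fun h => hmem (Or.inl h), by_contra fun h => hmem (Or.inr ?_)⟩
    rw [hammingDist_eq_sum] at h
    exact h

end Achievability

end SuperpositionCoding

/-! ### The main theorem. -/

theorem theorem1 {G : Type*} [AddGroup G] [Fintype G] [DecidableEq G]
    (l : ℕ) (hl : 1 ≤ l) (hG : Fintype.card G = 2 ^ l)
    (p q : G → ℝ) (hp : p ∈ stdSimplex ℝ G) (hq : q ∈ stdSimplex ℝ G)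
    (D : ℝ) (hD0 : 0 ≤ D) (hD1 : D ≤ 1)
    (R₀ R₁ : ℝ) (M₀ M₁ : ℕ → ℕ) (hM₀ : HasRate M₀ R₀) (hM₁ : HasRate M₁ R₁)
    (hR₀ : R₀ > (l : ℝ) - entropy (conv q (distortionLaw G D)))
    (hR : R₀ + R₁ > entropy (sourceLaw p) - entropy (distortionLaw G D)) :
    -- exact constraint `D`, any encoder; the test channel is tightened by the tolerance
    (∃ ε₀ > 0, ∀ ε, 0 < ε → ε < ε₀ →
      ∀ enc : ∀ n, Encoder G n (M₀ n) (M₁ n),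
        (∀ n, IsTypicalEncoder (testLaw p (max 0 (D - ε))) ε (enc n)) →
        Tendsto (fun n => encoderErrorProb p q (enc n) D) atTop (𝓝 0)) ∧
    (∀ ε > 0,
      -- test channel with law `d` itself, any encoder; constraint `D` up to the tolerance
      (∀ enc : ∀ n, Encoder G n (M₀ n) (M₁ n),
        (∀ n, IsTypicalEncoder (testLaw p D) ε (enc n)) →
        Tendsto (fun n => encoderErrorProb p q (enc n) (D + ε)) atTop (𝓝 0)) ∧
      -- test channel with law `d` itself, suitable choice among typical pairs; constraint `D`
      (∃ enc : ∀ n, Encoder G n (M₀ n) (M₁ n),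
        (∀ n, IsTypicalEncoder (testLaw p D) ε (enc n)) ∧
        Tendsto (fun n => encoderErrorProb p q (enc n) D) atTop (𝓝 0))) ∧
    -- `H(X) - H(d)` is the value at `D` of the rate-distortion function of the source
    (D ≤ 1 - 1 / (2 : ℝ) ^ l →
      IsLeast (achievableInfo (sourceLaw p) D)
        (entropy (sourceLaw p) - entropy (distortionLaw G D))) := by
  have hG2 : 2 ≤ Fintype.card G := hG ▸ Nat.le_self_pow (by omega) 2
  have hlog : Real.logb 2 (Fintype.card G) = l := by
    rw [hG, Nat.cast_pow, Nat.cast_ofNat, Real.logb_pow, Real.logb_self_eq_one one_lt_two, mul_one]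
  rw [gt_iff_lt, ← hlog] at hR₀
  have hR' := hR
  rw [gt_iff_lt, sourceLaw_eq_uniform hp.2, entropy_uniform] at hR'
  -- The strict rate conditions are open in the noise level.
  have hC : {D' | Real.logb 2 (Fintype.card G) - entropy (conv q (distortionLaw G D')) < R₀ ∧
      Real.logb 2 (Fintype.card G) - entropy (distortionLaw G D') < R₀ + R₁} ∈ 𝓝 D :=
    ((continuous_const.sub (continuous_entropy_conv_distortionLaw q)).continuousAt.eventually
      (gt_mem_nhds hR₀)).and
    ((continuous_const.sub continuous_entropy_distortionLaw).continuousAt.eventually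
      (gt_mem_nhds hR'))
  refine ⟨?_, fun ε hε => ⟨fun enc henc => ?_, ?_⟩, fun hD => ?_⟩
  · have hcont : Tendsto (fun ε => max 0 (D - ε)) (𝓝 0) (𝓝 D) := by
      have : Continuous fun ε => max 0 (D - ε) := by fun_prop
      simpa [hD0] using this.tendsto 0
    obtain ⟨ε₀, hε₀, hball⟩ := Metric.mem_nhds_iff.1 (hcont hC)
    refine ⟨ε₀, hε₀, fun ε hε hεε₀ enc henc => ?_⟩
    have hrate := hball (show ε ∈ Metric.ball 0 ε₀ by
      rwa [Metric.mem_ball, Real.dist_eq, sub_zero, abs_of_pos hε])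
    have hD'0 : 0 ≤ max 0 (D - ε) := le_max_left _ _
    have hD'1 : max 0 (D - ε) ≤ 1 := max_le zero_le_one (by linarith)
    refine tendsto_encoderErrorProb hp hq (fun n => (henc n).isLaw) (fun n c₀ c₁ x hs s h0 => ?_)
      (tendsto_uncoveredProb_jointlyTypical hp.2 hq hG2 hD'0 hD'1 hM₀ hM₁ hrate.1 hrate.2 hε)
    have ht := (henc n).typical c₀ c₁ x hs s h0
    -- Either the level is `0` and the distortion vanishes, or the tolerance exactly fills the gap
    -- from `D - ε` to `D`.
    rcases le_total (D - ε) 0 with hle | hle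
    · rw [max_eq_left hle] at ht
      rwa [ht.hammingDist_eq_zero, zero_div]
    · rw [max_eq_right hle] at ht
      have := ht.hammingDist_le hp.2 hG2 hle (by linarith) hε.le
      linarith
  · exact tendsto_encoderErrorProb hp hq (fun n => (henc n).isLaw)
      (fun n c₀ c₁ x hs s h0 => ((henc n).typical c₀ c₁ x hs s h0).hammingDist_le hp.2 hG2
        hD0 hD1 (le_of_lt hε))
      (tendsto_uncoveredProb_jointlyTypical hp.2 hq hG2 hD0 hD1 hM₀ hM₁ hR₀ hR' hε)
  -- The codes are analysed with the channel of level `D'`, while the encoder tests typicality at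
  -- level `D` and prefers pairs meeting the constraint.
  · obtain ⟨D', hD'C, hD'0, hD'1, hlim⟩ := exists_testLaw_typical_and_le hp.2 hG2 hD0 hD1 hC hε
    choose enc henc hgood using fun n => exists_isTypicalEncoder (testLaw p D) ε (n := n)
      (hM₀.1 n) (hM₁.1 n) fun x w => (hammingDist x w : ℝ) / n ≤ D
    exact ⟨enc, henc, tendsto_encoderErrorProb hp hq (fun n => (henc n).isLaw)
      (T := fun n x => {w | JointlyTypical (testLaw p D) ε x w ∧ (hammingDist x w : ℝ) / n ≤ D})
      hgood (tendsto_uncoveredProb_of_testLaw hp.2 hq hG2 hD'0 hD'1 hM₀ hM₁ hD'C.1 hD'C.2 hlim)⟩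
  · refine isLeast_achievableInfo hp.2 hG2 hD0 ?_
    rwa [hG, Nat.cast_pow, Nat.cast_ofNat]
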